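/- **Setting.** Consider the planar problem of two planets around a body of mass $m_0>0$, with gravitational constant $G>0$ and planetary masses $\varepsilon m_1,\varepsilon m_2$, where $m_1,m_2>0$ are fixed and $\max(m_1,m_2)=m_0$; thus $\varepsilon\in(0,1]$ is the larger of the two planet/star mass ratios. Put $$\beta_j=\frac{m_0m_j}{m_0+\varepsilon m_j},\qquad \mu_j=G(m_0+\varepsilon m_j).$$ Fix the common mean motion $\omega>0$ and let $\Lambda_j^0>0$ be defined by $\mu_j^2\beta_j^3/(\Lambda_j^0)^3=\omega$. Let $$a=\min_j\frac{(\Lambda_j^0)^2}{\beta_j^2\mu_j},\qquad \delta=2a\sin(\Delta/2)\quad\text{for } 0<\Delta<\pi .$$ *Poincaré variables.* The real Poincaré variables of planet $j$ are $(\lambda_j,\Lambda_j,x_j,-i\bar x_j)$, where $\lambda_j$ is the mean longitude, $\Lambda_j=\beta_j\sqrt{\mu_ja_j}$ and $x_j=\sqrt{\Lambda_j}\sqrt{1-\sqrt{1-e_j^2}}\,e^{i\varpi_j}$, for semi-major axis $a_j$, eccentricity $e_j$ and longitude of pericentre $\varpi_j$. They determine the heliocentric position $\mathbf r_j\in\mathbb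 R^2$ and the momentum $\mathbf R_j=\beta_j\dot{\mathbf r}_j\in\mathbb R^2$ on the corresponding Kepler ellipse (attraction parameter $\mu_j$). The resonant variables are $\zeta_1=\lambda_1-\lambda_2$, $\zeta_2=\lambda_2$, $Z_1=\Lambda_1-\Lambda_1^0$, $Z_2=(\Lambda_1-\Lambda_1^0)+(\Lambda_2-\Lambda_2^0)$, $\xi_j=x_j$, $\eta_j=-i\bar x_j$. *Complex domain.* Let $K_{\Delta,\rho,\sigma}\subset\mathbb C^8$ be the set of $(\zeta_j,Z_j,\xi_j,\eta_j)_{j=1,2}$ such that the distance of $\mathrm{Re}\,\zeta_1$ to $2\pi\mathbb Z$ is greater than $\Delta$ and, for $j=1,2$, $|Z_j|\le\rho$, $|\xi_j|\le\sqrt{\rho\sigma}$, $|\eta_j|\le\sqrt{\rho\sigma}$, $|\mathrm{Im}\,\zeta_j|\le\sigma$. Its real points are those with $\zeta_j,Z_j$ real and $\eta_j=-i\bar\xi_j$. *Hamiltonian.* The Keplerian part is $H_K(Z_1,Z_2)=-\sum_j\mu_j^2\beta_j^3/(2\Lambda_j^2)$, with $\Lambda_1=\Lambda_1^0+Z_1$,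 $\Lambda_2=\Lambda_2^0+Z_2-Z_1$. The perturbing part is $$H_P=\varepsilon\left(\frac{\mathbf R_1\cdot\mathbf R_2}{m_0}-\frac{Gm_1m_2}{\|\mathbf r_1-\mathbf r_2\|}\right).$$ **Theorem.** There are constants $\rho_0,\sigma_0,M>0$ and $C_0>1$, independent of $\varepsilon\in(0,1]$ and of $\Delta\in(0,\pi)$, with the following properties. 1. For every $\varepsilon$, $H_K$ is holomorphic on a neighbourhood of $\{|Z_1|,|Z_2|\le\rho_0\}$, and all its partial derivatives of order at most $3$ have modulus $<M$ there. 2. For every $\varepsilon$ there is a map $\Upsilon$ such that, for every $\Delta$, $\Upsilon$ is holomorphic on a neighbourhood of $K_{\Delta,\rho_0,\sigma_0}$, it agrees at the real points of this set with the map from the resonant Poincaré variables to $(\mathbf R_1,\mathbf r_1,\mathbf R_2,\mathbf r_2)$, and $\|d\Upsilon\|\le C_0$ on $K_{\Delta,\rho_0,\sigma_0}$ (operator norm for the maximum norms on $\mathbb C^8$). 3. Let $C>1$ be any constant with $\|d\Upsilon\|\le C$ on $K_{\Delta,\rho_0,\sigma_0}$. Suppose $$0<\rho<\sigma<1,\qquad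 \rho\le\rho_0,\qquad \sigma\le\sigma_0,\qquad \sigma\le\frac{\delta}{16C}.$$ Then, with $(\mathbf R_1,\mathbf r_1,\mathbf R_2,\mathbf r_2)=\Upsilon(\cdot)$, at every point of $K_{\Delta,\rho,\sigma}$ the Hermitian norm of $\mathbf r_1-\mathbf r_2\in\mathbb C^2$ is at least $\delta/2$ and $(\mathbf r_1-\mathbf r_2)\cdot(\mathbf r_1-\mathbf r_2)\neq0$, where the dot denotes the bilinear product. The function $H_P$, in which $\|\mathbf r_1-\mathbf r_2\|$ is the principal square root of $(\mathbf r_1-\mathbf r_2)\cdot(\mathbf r_1-\mathbf r_2)$, is holomorphic on a neighbourhood of $K_{\Delta,\rho,\sigma}$, and $$\frac{\varepsilon}{M}<\inf_{K_{\Delta,\rho,\sigma}}|H_P|,\qquad \sup_{K_{\Delta,\rho,\sigma}}|H_P|<M\,\frac{\varepsilon}{\delta}.$$ -/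

import Mathlib

open Complex Set

namespace CoOrbital

noncomputable section

/-- The data kept fixed while the small parameter `ε` varies: gravitational constant, mass of the
central body, common mean motion at the 1:1 resonance, and the rescaled masses of the two planets
(the true planetary masses are `ε * m j`). -/
structure Params where
  G : ℝ
  m₀ : ℝ
  ω : ℝ
  m : Fin 2 → ℝ

/-- Reduced mass `β_j = m₀ m_j / (m₀ + ε m_j)`. -/
def redMass (P : Params) (ε : ℝ) (j : Fin 2) : ℝ := P.m₀ * P.m j / (P.m₀ + ε * P.m j)

/-- `μ_j = G (m₀ + ε m_j)`. -/
def gravParam (P : Params) (ε : ℝ) (j : Fin 2) : ℝ := P.G * (P.m₀ + ε * P.m j)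

/-- The resonant action `Λ_j⁰`, i.e. the positive solution of `μ_j² β_j³ / (Λ_j⁰)³ = ω`. -/
def resAction (P : Params) (ε : ℝ) (j : Fin 2) : ℝ :=
  (gravParam P ε j ^ 2 * redMass P ε j ^ 3 / P.ω) ^ (1 / 3 : ℝ)

/-- Radius of the resonant circular orbit of planet `j`. -/
def resRadius (P : Params) (ε : ℝ) (j : Fin 2) : ℝ :=
  resAction P ε j ^ 2 / (redMass P ε j ^ 2 * gravParam P ε j)

/-- `δ = 2 a sin (Δ / 2)`, where `a` is the smaller of the two resonant radii. -/
def minDist (P : Params) (ε Δ : ℝ) : ℝ :=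
  2 * min (resRadius P ε 0) (resRadius P ε 1) * Real.sin (Δ / 2)

/-- `ℂ⁸` with coordinates `(ζ, Z, ξ, η)`, each a pair indexed by the planets; its norm is the
maximum norm. -/
abbrev Coords : Type := (Fin 2 → ℂ) × (Fin 2 → ℂ) × (Fin 2 → ℂ) × (Fin 2 → ℂ)

/-- `ℂ⁸` as the space of pairs `(R, r)`: `R j` and `r j` in `ℂ²` are the (rescaled) momentum and
the heliocentric position of planet `j`; its norm is the maximum norm. -/
abbrev State : Type := (Fin 2 → Fin 2 → ℂ) × (Fin 2 → Fin 2 → ℂ)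

def Coords.ζ (p : Coords) : Fin 2 → ℂ := p.1
def Coords.Z (p : Coords) : Fin 2 → ℂ := p.2.1
def Coords.ξ (p : Coords) : Fin 2 → ℂ := p.2.2.1
def Coords.η (p : Coords) : Fin 2 → ℂ := p.2.2.2

/-- Mean longitudes: `ζ₁ = λ₁ - λ₂`, `ζ₂ = λ₂`. -/
def meanLong (p : Coords) : Fin 2 → ℂ := ![Coords.ζ p 0 + Coords.ζ p 1, Coords.ζ p 1]

/-- Actions: `Z₁ = Λ₁ - Λ₁⁰`, `Z₂ = (Λ₁ - Λ₁⁰) + (Λ₂ - Λ₂⁰)`. -/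
def actions (P : Params) (ε : ℝ) (Z : Fin 2 → ℂ) : Fin 2 → ℂ :=
  ![(resAction P ε 0 : ℂ) + Z 0, (resAction P ε 1 : ℂ) + Z 1 - Z 0]

/-- The complex domain `K_{Δ,ρ,σ}`. The norm of `AddCircle (2 * π)` is the distance to `0`
in `ℝ / 2πℤ`. -/
def dom (Δ ρ σ : ℝ) : Set Coords :=
  {p | Δ < ‖(((Coords.ζ p 0).re : ℝ) : AddCircle (2 * Real.pi))‖ ∧
    ∀ j, ‖Coords.Z p j‖ ≤ ρ ∧ ‖Coords.ξ p j‖ ≤ √(ρ * σ) ∧ ‖Coords.η p j‖ ≤ √(ρ * σ) ∧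
      |(Coords.ζ p j).im| ≤ σ}

/-- The points that come from real Poincaré variables: `ζ`, `Z` real and `η = -i x̄` for `ξ = x`. -/
def IsRealPoint (p : Coords) : Prop :=
  ∀ j, (Coords.ζ p j).im = 0 ∧ (Coords.Z p j).im = 0 ∧
    Coords.η p j = -I * (starRingEnd ℂ) (Coords.ξ p j)

/-- The planar Kepler state (momentum `R = β ṙ`, position `r`) with real Poincaré variables
`(l, L, x)`: there are elliptic elements, namely a semi-major axis `a`, an eccentricity `e`,
a longitude of pericentre `w` and an eccentric anomaly `E`, such that `L = β √(μ a)`,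
`x = √L √(1 - √(1 - e²)) exp (i w)`, Kepler's equation `E - e sin E = l - w` holds, and `(R, r)` is
the corresponding point of the Kepler ellipse. -/
def IsKeplerState (β μ l L : ℝ) (x : ℂ) (R r : Fin 2 → ℝ) : Prop :=
  ∃ a e w E : ℝ, 0 < a ∧ 0 ≤ e ∧ e < 1 ∧
    L = β * √(μ * a) ∧
    x = ((√L * √(1 - √(1 - e ^ 2)) : ℝ) : ℂ) * exp ((w : ℂ) * I) ∧
    E - e * Real.sin E = l - w ∧
    r = ![a * ((Real.cos E - e) * Real.cos w - √(1 - e ^ 2) * Real.sin E * Real.sin w),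
          a * ((Real.cos E - e) * Real.sin w + √(1 - e ^ 2) * Real.sin E * Real.cos w)] ∧
    R = ![β * (√(μ / a) / (1 - e * Real.cos E)) *
            (-Real.sin E * Real.cos w - √(1 - e ^ 2) * Real.cos E * Real.sin w),
          β * (√(μ / a) / (1 - e * Real.cos E)) *
            (-Real.sin E * Real.sin w + √(1 - e ^ 2) * Real.cos E * Real.cos w)]

/-- `U` is holomorphic on (a neighbourhood of) `K` and extends the map sending real resonant
Poincaré variables to the momenta and positions of the two planets. -/
def IsHolomorphicExtension (P : Params) (ε : ℝ) (U : Coords → State) (K : Set Coords) : Prop :=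
  AnalyticOnNhd ℂ U K ∧
    ∀ p ∈ K, IsRealPoint p → ∀ j, ∃ R r : Fin 2 → ℝ,
      IsKeplerState (redMass P ε j) (gravParam P ε j) (meanLong p j).re
        (actions P ε (Coords.Z p) j).re (Coords.ξ p j) R r ∧
      (∀ i, (U p).1 j i = (R i : ℂ)) ∧ (∀ i, (U p).2 j i = (r i : ℂ))

/-- Bilinear (not sesquilinear) square of `r₁ - r₂`, the holomorphic extension of the squared
distance. -/
def distSq (s : State) : ℂ := ∑ i, (s.2 0 i - s.2 1 i) ^ 2

/-- Hermitian norm of `r₁ - r₂` in `ℂ²`. -/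
def hermDist (s : State) : ℝ := √(∑ i, ‖s.2 0 i - s.2 1 i‖ ^ 2)

/-- The perturbing part `ε (R₁ · R₂ / m₀ - G m₁ m₂ / ‖r₁ - r₂‖)` of the planetary Hamiltonian in
complexified momenta and positions, with the principal square root. -/
def perturbation (P : Params) (ε : ℝ) (s : State) : ℂ :=
  (ε : ℂ) * ((∑ i, s.1 0 i * s.1 1 i) / (P.m₀ : ℂ)
    - (P.G * P.m 0 * P.m 1 : ℂ) / distSq s ^ (1 / 2 : ℂ))

/-- The Keplerian part `H_K(Z₁, Z₂) = -∑ μ_j² β_j³ / (2 Λ_j²)`. -/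
def keplerian (P : Params) (ε : ℝ) (z : ℂ × ℂ) : ℂ :=
  -∑ j, ((gravParam P ε j : ℂ) ^ 2 * (redMass P ε j : ℂ) ^ 3) /
    (2 * actions P ε ![z.1, z.2] j ^ 2)

/-- `H_K` is holomorphic on the closed polydisc of radius `ρ`, and all its partial derivatives of
order at most 3 are there smaller than `M` in modulus. -/
def KeplerianBound (P : Params) (ε ρ M : ℝ) : Prop :=
  AnalyticOnNhd ℂ (keplerian P ε) {z | ‖z.1‖ ≤ ρ ∧ ‖z.2‖ ≤ ρ} ∧
    ∀ k l : ℕ, k + l ≤ 3 → ∀ z₁ z₂ : ℂ, ‖z₁‖ ≤ ρ → ‖z₂‖ ≤ ρ →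
      ‖iteratedDeriv k (fun s => iteratedDeriv l (fun t => keplerian P ε (s, t)) z₂) z₁‖ < M

end

end CoOrbital

/-!
The proof constructs the complexified Kepler map explicitly and compares every point of the domain
with the real circular configuration below it.

*Kepler map.* In terms of the eccentric longitude `F = E + w` and of the variables `e exp (± i w)`,
position and momentum on a Kepler ellipse are given by formulas which stay holomorphic at circular
orbits (`posForm`, `momForm`, `keplerMap`). The difference `F - l` is a holomorphic function of
`e exp (± i (l - w))`, obtained from the implicit function theorem applied to Kepler's equation at a
single point (`exists_kepler_solution`); it is real at real points because the conjugate of a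
solution solves the same equation. Since the mean longitude enters only through these two small
quantities and through bounded exponentials, the Kepler map is bounded on a full complex strip,
uniformly for parameters in a compact set (`exists_kepler_chart`). The masses, actions and radii do
stay in a compact subset of `(0, ∞)` when `ε` varies (`exists_uniform_bounds`), and Cauchy's
estimate turns the bound on the map into a bound on its derivative.

*Comparison with circular orbits.* A point of the domain is at distance at most `σ` from the point
with the same `Re ζ` and with `Im ζ = 0`, `Z = ξ = η = 0`, whose image is a pair of points on
concentric circles, at a mutual distance `D ≥ δ`. The mean value inequality bounds the difference of
the two states by `C σ ≤ δ / 16`, and also by a constant as small as desired through the choice of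
`σ₀`. The first bound keeps the complex squared distance within `0.4 D²` of `D²`, hence in the slit
plane, where its inverse square root has real part at least `0.8 / D` (`inv_sqrt_estimates`). The
second one controls the product of the momenta.

*Lower bound.* On circular orbits the perturbation is `ε G m₁ m₂ (κ cos θ / (a₁ a₂)² - 1 / D)` with
`κ = G m₀ / ω²`, and Kepler's third law gives `κ ≤ a_j³`. An elementary cubic inequality then yields
`κ cos θ / (a₁ a₂)² ≤ 0.55 / D` (`indirect_le_direct`), so that the indirect part cannot cancel the
direct one, not even after the perturbation (`perturbation_estimates`).
-/

namespace CoOrbital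

noncomputable section

open Filter Topology ContDiff

/-! ### Kepler's equation -/

/-- Kepler's equation `u = e sin (u + c)` in complexified form, with `P = e exp (i c)` and
`Q = e exp (-i c)` as independent variables: near the origin it has a holomorphic solution, which
is real wherever `Q` is the conjugate of `P`. -/
theorem exists_kepler_solution :
    ∃ r : ℝ, 0 < r ∧ r ≤ 1 / 4 ∧ ∃ φ : ℂ × ℂ → ℂ, φ (0, 0) = 0 ∧
      ∀ P Q : ℂ, ‖P‖ < r → ‖Q‖ < r → AnalyticAt ℂ φ (P, Q) ∧ ‖φ (P, Q)‖ ≤ 1 / 2 ∧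
        φ (P, Q) = (P * exp (I * φ (P, Q)) - Q * exp (-(I * φ (P, Q)))) / (2 * I) ∧
        (Q = (starRingEnd ℂ) P → (starRingEnd ℂ) (φ (P, Q)) = φ (P, Q)) := by
  let f : (ℂ × ℂ) × ℂ → ℂ :=
    fun v => v.2 - (v.1.1 * exp (I * v.2) - v.1.2 * exp (-(I * v.2))) / (2 * I)
  have hf : ContDiffAt ℂ ω f ((0, 0), 0) := by
    simp only [f]
    fun_prop
  have hω : (ω : WithTop ℕ∞) ≠ 0 := by simp
  have hinv : (fderiv ℂ f ((0, 0), 0) ∘L .inr ℂ (ℂ × ℂ) ℂ).IsInvertible := by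
    have h1 : fderiv ℂ f ((0, 0), 0) ∘L .inr ℂ (ℂ × ℂ) ℂ
        = ContinuousLinearMap.id ℂ ℂ := by
      have hcomp : HasFDerivAt (fun y : ℂ => f ((0, 0), y))
          (fderiv ℂ f ((0, 0), 0) ∘L .inr ℂ (ℂ × ℂ) ℂ) 0 :=
        (hf.differentiableAt hω).hasFDerivAt.comp (0 : ℂ) (hasFDerivAt_prodMk_right _ _)
      have hid : (fun y : ℂ => f ((0, 0), y)) = id := by
        funext y; simp [f]
      rw [hid] at hcomp
      exact hcomp.unique (hasFDerivAt_id 0)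
    rw [h1]
    exact ⟨ContinuousLinearEquiv.refl ℂ ℂ, rfl⟩
  let φ := hf.implicitFunction hω hinv
  have hφ0 : φ (0, 0) = 0 := hf.implicitFunction_apply_self hω hinv
  have hf0 : f ((0, 0), 0) = 0 := by simp [f]
  have hφa : AnalyticAt ℂ φ (0, 0) :=
    (hf.contDiffAt_implicitFunction hω hinv).analyticAt
  have hsol : ∀ᶠ p in 𝓝 ((0 : ℂ), (0 : ℂ)), f (p, φ p) = 0 := by
    have := hf.eventually_apply_implicitFunction hω hinv
    rwa [hf0] at this
  have huniq : ∀ᶠ v in 𝓝 (((0 : ℂ), (0 : ℂ)), (0 : ℂ)), f v = 0 ↔ φ v.1 = v.2 := by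
    have := hf.eventually_apply_eq_iff_implicitFunction hω hinv
    rwa [hf0] at this
  obtain ⟨s, hs, hsu⟩ := Metric.eventually_nhds_iff_ball.1 huniq
  have hsmall : ∀ᶠ p in 𝓝 ((0 : ℂ), (0 : ℂ)), φ p ∈ Metric.ball (0 : ℂ) (min s (1 / 2)) := by
    have := hφa.continuousAt.eventually_mem (Metric.ball_mem_nhds (φ (0, 0))
      (lt_min hs one_half_pos))
    rwa [hφ0] at this
  obtain ⟨t, ht, htu⟩ := Metric.eventually_nhds_iff_ball.1
    ((hφa.eventually_analyticAt.and hsol).and hsmall)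
  refine ⟨min (min s t) (1 / 4), by positivity, min_le_right _ _, φ, hφ0, ?_⟩
  intro P Q hP hQ
  simp only [lt_min_iff] at hP hQ
  have hPQ : ∀ c : ℝ, ‖P‖ < c → ‖Q‖ < c → (P, Q) ∈ Metric.ball ((0 : ℂ), (0 : ℂ)) c := by
    intro c h1 h2
    simp [Prod.dist_eq, h1, h2]
  obtain ⟨⟨ha, heq⟩, hsm⟩ := htu (P, Q) (hPQ t hP.1.2 hQ.1.2)
  have hsm' : ‖φ (P, Q)‖ < s ∧ ‖φ (P, Q)‖ < 1 / 2 := by simpa using hsm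
  have heq' : φ (P, Q) = (P * exp (I * φ (P, Q)) - Q * exp (-(I * φ (P, Q)))) / (2 * I) :=
    sub_eq_zero.1 heq
  refine ⟨ha, hsm'.2.le, heq', ?_⟩
  rintro rfl
  -- the conjugate of the solution solves the same equation
  set c := φ (P, (starRingEnd ℂ) P) with hc
  have hmem : ((P, (starRingEnd ℂ) P), (starRingEnd ℂ) c) ∈
      Metric.ball (((0 : ℂ), (0 : ℂ)), (0 : ℂ)) s := by
    simp [Prod.dist_eq, hP.1.1, hsm'.1]
  refine ((hsu _ hmem).1 (sub_eq_zero.2 ?_)).symm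
  have h2 := congrArg (starRingEnd ℂ) heq'
  simp only [map_div₀, map_sub, map_mul, map_neg, ← exp_conj, conj_I, Complex.conj_conj,
    map_ofNat] at h2
  refine h2.trans ?_
  simp only [mul_neg, div_neg, neg_mul, neg_neg, ← neg_div, neg_sub]

/-! ### The Kepler map of one planet in complex Poincaré variables -/

/-- The factor `√((2 - q) / L)`, where `q = x x̄ / L = 1 - √(1 - e²)`, for which
`x √((2 - q) / L) = e exp (i w)`. The argument is `v = (l, L, x, -i x̄)`, so that `x̄` is
`I * v.2.2.2`. -/
def eccFactor (v : ℂ × ℂ × ℂ × ℂ) : ℂ :=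
  ((2 - v.2.2.1 * (I * v.2.2.2) / v.2.1) / v.2.1) ^ (1 / 2 : ℂ)

/-- `e exp (i (l - w))`. -/
def eccPos (v : ℂ × ℂ × ℂ × ℂ) : ℂ := I * v.2.2.2 * eccFactor v * exp (I * v.1)

/-- `e exp (-i (l - w))`. -/
def eccNeg (v : ℂ × ℂ × ℂ × ℂ) : ℂ := v.2.2.1 * eccFactor v * exp (-(I * v.1))

/-- The difference `E + w - l` of the eccentric and mean longitudes, for a solution `φ` of Kepler's
equation. -/
def longDiff (φ : ℂ × ℂ → ℂ) (v : ℂ × ℂ × ℂ × ℂ) : ℂ := φ (eccPos v, eccNeg v)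

/-- `r₁ + i r₂` for `y = x`, `s = i` times the eccentric longitude, and `r₁ - i r₂` for `y = x̄`,
`s = -i` times the eccentric longitude. -/
def posForm (β μ : ℝ) (v : ℂ × ℂ × ℂ × ℂ) (y s : ℂ) : ℂ :=
  v.2.1 ^ 2 / (β ^ 2 * μ) * (-(y * eccFactor v) +
    (1 - v.2.2.1 * (I * v.2.2.2) / v.2.1 / 2) * exp s + y ^ 2 / (2 * v.2.1) * exp (-s))

/-- `(R₁ + i R₂) / i` or `(R₁ - i R₂) / (-i)`, with the conventions of `posForm`; the denominator
is `1 - e cos E`. -/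
def momForm (φ : ℂ × ℂ → ℂ) (β μ : ℝ) (v : ℂ × ℂ × ℂ × ℂ) (y s : ℂ) : ℂ :=
  β ^ 2 * μ / v.2.1 /
    (1 - (eccPos v * exp (I * longDiff φ v) + eccNeg v * exp (-(I * longDiff φ v))) / 2) *
    ((1 - v.2.2.1 * (I * v.2.2.2) / v.2.1 / 2) * exp s - y ^ 2 / (2 * v.2.1) * exp (-s))

/-- Momentum and position of one planet as functions of its complex Poincaré variables
`(l, L, x, -i x̄)`. The eccentric longitude, unlike the eccentric anomaly and the longitude of
pericentre, is holomorphic at circular orbits. -/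
def keplerMap (φ : ℂ × ℂ → ℂ) (β μ : ℝ) (v : ℂ × ℂ × ℂ × ℂ) : (Fin 2 → ℂ) × (Fin 2 → ℂ) :=
  let s := I * (v.1 + longDiff φ v)
  let A := posForm β μ v v.2.2.1 s
  let B := posForm β μ v (I * v.2.2.2) (-s)
  let V := momForm φ β μ v v.2.2.1 s
  let W := momForm φ β μ v (I * v.2.2.2) (-s)
  (![I * (V - W) / 2, (V + W) / 2], ![(A + B) / 2, (A - B) / (2 * I)])

theorem keplerMap_circular {φ : ℂ × ℂ → ℂ} (hφ : φ (0, 0) = 0) (β μ l L : ℝ) :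
    keplerMap φ β μ (l, L, 0, 0) =
      (![((-(β ^ 2 * μ / L * Real.sin l) : ℝ) : ℂ), ((β ^ 2 * μ / L * Real.cos l : ℝ) : ℂ)],
       ![((L ^ 2 / (β ^ 2 * μ) * Real.cos l : ℝ) : ℂ),
         ((L ^ 2 / (β ^ 2 * μ) * Real.sin l : ℝ) : ℂ)]) := by
  have h1 : exp (I * l) = Real.cos l + Real.sin l * I := by
    rw [mul_comm, exp_mul_I]; simp
  have h2 : exp (-(I * l)) = Real.cos l - Real.sin l * I := by
    rw [mul_comm, ← neg_mul, exp_mul_I]; simp [sub_eq_add_neg]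
  have h3 : longDiff φ ((l : ℂ), (L : ℂ), 0, 0) = 0 := by
    simp [longDiff, eccPos, eccNeg, hφ]
  have hp : eccPos ((l : ℂ), (L : ℂ), 0, 0) = 0 := by simp [eccPos]
  have hn : eccNeg ((l : ℂ), (L : ℂ), 0, 0) = 0 := by simp [eccNeg]
  have hI := I_ne_zero
  simp only [keplerMap, posForm, momForm, h3, hp, hn]
  simp only [add_zero, mul_zero, zero_mul, neg_zero, zero_add, zero_div, sub_zero, one_mul,
    neg_neg, div_one, h1, h2, ne_eq, OfNat.ofNat_ne_zero, not_false_eq_true, zero_pow]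
  push_cast
  refine Prod.ext ?_ ?_
  · refine congrArg₂ (fun a b => ![a, b]) ?_ ?_
    · linear_combination ((β : ℂ) ^ 2 * μ / L * Complex.sin l) * I_sq
    · ring
  · refine congrArg₂ (fun a b => ![a, b]) ?_ ?_
    · ring
    · field_simp
      ring

/-- On real Poincaré variables with `‖x‖² < L` the Kepler map takes the values that define the
Poincaré variables. -/
theorem keplerMap_real {φ : ℂ × ℂ → ℂ} {β μ l L : ℝ} {x : ℂ} (hβ : 0 < β) (hμ : 0 < μ)
    (hL : 0 < L) (hx : ‖x‖ ^ 2 < L)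
    (hre : let v : ℂ × ℂ × ℂ × ℂ := (l, L, x, -I * (starRingEnd ℂ) x)
      (starRingEnd ℂ) (longDiff φ v) = longDiff φ v ∧
      longDiff φ v = (eccPos v * exp (I * longDiff φ v)
        - eccNeg v * exp (-(I * longDiff φ v))) / (2 * I)) :
    ∃ R r : Fin 2 → ℝ, IsKeplerState β μ l L x R r ∧
      (∀ i, (keplerMap φ β μ (l, L, x, -I * (starRingEnd ℂ) x)).1 i = (R i : ℂ)) ∧
      (∀ i, (keplerMap φ β μ (l, L, x, -I * (starRingEnd ℂ) x)).2 i = (r i : ℂ)) := by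
  obtain ⟨hconj, hkep⟩ := hre
  set v : ℂ × ℂ × ℂ × ℂ := (l, L, x, -I * (starRingEnd ℂ) x) with hv
  obtain ⟨u, hu⟩ := Complex.conj_eq_iff_real.1 hconj
  rw [hu] at hkep
  set q : ℝ := ‖x‖ ^ 2 / L with hq
  have hq0 : 0 ≤ q := by positivity
  have hq1 : q < 1 := (div_lt_one hL).2 hx
  set s : ℝ := √((2 - q) / L) with hs
  have hs2 : s ^ 2 = (2 - q) / L := Real.sq_sqrt (div_nonneg (by linarith) hL.le)
  have hs0 : 0 ≤ s := Real.sqrt_nonneg _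
  set e : ℝ := ‖x‖ * s with he
  have he0 : 0 ≤ e := by positivity
  have he2 : e ^ 2 = q * (2 - q) := by
    rw [he, mul_pow, hs2, hq]; ring
  have hroot : √(1 - e ^ 2) = 1 - q := by
    rw [he2, show 1 - q * (2 - q) = (1 - q) ^ 2 by ring, Real.sqrt_sq (by linarith)]
  have he1 : e < 1 := by nlinarith [sq_nonneg (1 - q), sq_pos_of_pos (sub_pos.2 hq1)]
  set w : ℝ := arg x with hw
  set E : ℝ := l + u - w with hE
  have hbar : I * (-I * (starRingEnd ℂ) x) = (starRingEnd ℂ) x := by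
    rw [← mul_assoc, mul_neg, I_mul_I]; simp
  have hqc : x * (I * (-I * (starRingEnd ℂ) x)) / (L : ℂ) = (q : ℂ) := by
    rw [hbar, mul_conj, hq, normSq_eq_norm_sq]; push_cast; rfl
  have hfac : eccFactor v = (s : ℂ) := by
    have : (1 / 2 : ℂ) = ((1 / 2 : ℝ) : ℂ) := by push_cast; rfl
    simp only [eccFactor, hv, hqc]
    rw [this, hs, Real.sqrt_eq_rpow, ofReal_cpow (div_nonneg (by linarith) hL.le)]
    push_cast; rfl
  -- the exponentials of `i w` and `i E`
  set t : ℂ := exp (w * I) with ht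
  set t' : ℂ := exp (-(w * I)) with ht'
  set k : ℂ := exp (E * I) with hk
  set k' : ℂ := exp (-(E * I)) with hk'
  have htt : t * t' = 1 := by rw [ht, ht', ← exp_add]; simp
  have hxt : x = ‖x‖ * t := (norm_mul_exp_arg_mul_I x).symm
  have hxt' : (starRingEnd ℂ) x = ‖x‖ * t' := by
    conv_lhs => rw [hxt]
    rw [map_mul, conj_ofReal, ht, ← exp_conj]; simp [ht']
  have htv : t = Real.cos w + Real.sin w * I := by rw [ht, exp_mul_I]; simp
  have htv' : t' = Real.cos w - Real.sin w * I := by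
    rw [ht', ← neg_mul, exp_mul_I]; simp [sub_eq_add_neg]
  have hkv : k = Real.cos E + Real.sin E * I := by rw [hk, exp_mul_I]; simp
  have hkv' : k' = Real.cos E - Real.sin E * I := by
    rw [hk', ← neg_mul, exp_mul_I]; simp [sub_eq_add_neg]
  have hpos : eccPos v * exp (I * u) = e * k := by
    have h1 : exp (I * l) * exp (I * u) = t * k := by
      rw [ht, hk, ← exp_add, ← exp_add, hE]; push_cast; ring_nf
    simp only [eccPos, hfac]
    simp only [hv]
    rw [hbar, hxt', mul_assoc, h1, he]
    push_cast
    linear_combination (‖x‖ * s * k : ℂ) * htt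
  have hneg : eccNeg v * exp (-(I * u)) = e * k' := by
    have h1 : exp (-(I * l)) * exp (-(I * u)) = t' * k' := by
      rw [ht', hk', ← exp_add, ← exp_add, hE]; push_cast; ring_nf
    simp only [eccNeg, hfac]
    simp only [hv]
    rw [mul_assoc, h1, he]
    conv_lhs => rw [hxt]
    push_cast
    linear_combination (‖x‖ * s * k' : ℂ) * htt
  have hplus : exp (I * ((l : ℂ) + u)) = t * k := by
    rw [ht, hk, ← exp_add, hE]; push_cast; ring_nf
  have hminus : exp (-(I * ((l : ℂ) + u))) = t' * k' := by
    rw [ht', hk', ← exp_add, hE]; push_cast; ring_nf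
  have hI := I_ne_zero
  have hu' : u = e * Real.sin E := by
    rw [hpos, hneg, hkv, hkv'] at hkep
    have : (u : ℂ) = ((e * Real.sin E : ℝ) : ℂ) := by
      rw [hkep]; push_cast; field_simp; ring
    exact_mod_cast this
  set a : ℝ := L ^ 2 / (β ^ 2 * μ) with ha
  have ha0 : 0 < a := by positivity
  have hLne : (L : ℂ) ≠ 0 := by exact_mod_cast hL.ne'
  have hqL : ((‖x‖ : ℝ) : ℂ) ^ 2 / (2 * L) = q / 2 := by
    rw [hq]; push_cast; field_simp
  have hA : posForm β μ v x (I * ((l : ℂ) + u)) =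
      a * t * ((Real.cos E - e) + I * ((1 - q) * Real.sin E)) := by
    simp only [posForm, hfac, hplus, hminus]
    simp only [hv, hqc]
    have h1 : x ^ 2 / (2 * L) * (t' * k') = t * (q / 2 * k') := by
      conv_lhs => rw [hxt]
      rw [← hqL]
      linear_combination ((‖x‖ : ℂ) ^ 2 / (2 * L) * t * k') * htt
    have h2 : x * s = e * t := by
      conv_lhs => rw [hxt]
      rw [he]; push_cast; ring
    rw [h1, h2, hkv, hkv', ha]
    push_cast
    ring
  have hB : posForm β μ v (I * (-I * (starRingEnd ℂ) x)) (-(I * ((l : ℂ) + u))) =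
      a * t' * ((Real.cos E - e) - I * ((1 - q) * Real.sin E)) := by
    simp only [posForm, hfac, neg_neg, hplus, hminus]
    simp only [hv, hqc]
    have h1 : (starRingEnd ℂ) x ^ 2 / (2 * L) * (t * k) = t' * (q / 2 * k) := by
      rw [hxt', ← hqL]
      linear_combination ((‖x‖ : ℂ) ^ 2 / (2 * L) * t' * k) * htt
    have h2 : (starRingEnd ℂ) x * s = e * t' := by
      rw [hxt', he]; push_cast; ring
    rw [hbar, h1, h2, hkv, hkv', ha]
    push_cast
    ring
  set d : ℝ := 1 - e * Real.cos E with hd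
  have hden : 1 - (eccPos v * exp (I * u) + eccNeg v * exp (-(I * u))) / 2 = (d : ℂ) := by
    rw [hpos, hneg, hkv, hkv', hd]; push_cast; ring
  have hV : momForm φ β μ v x (I * ((l : ℂ) + u)) =
      β ^ 2 * μ / L / d * t * ((1 - q) * Real.cos E + I * Real.sin E) := by
    simp only [momForm, hu, hden, hplus, hminus]
    simp only [hv, hqc]
    have h1 : x ^ 2 / (2 * L) * (t' * k') = t * (q / 2 * k') := by
      conv_lhs => rw [hxt]
      rw [← hqL]
      linear_combination ((‖x‖ : ℂ) ^ 2 / (2 * L) * t * k') * htt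
    rw [h1, hkv, hkv']
    ring
  have hW : momForm φ β μ v (I * (-I * (starRingEnd ℂ) x)) (-(I * ((l : ℂ) + u))) =
      β ^ 2 * μ / L / d * t' * ((1 - q) * Real.cos E - I * Real.sin E) := by
    simp only [momForm, hu, hden, neg_neg, hplus, hminus]
    simp only [hv, hqc]
    have h1 : (starRingEnd ℂ) x ^ 2 / (2 * L) * (t * k) = t' * (q / 2 * k) := by
      rw [hxt', ← hqL]
      linear_combination ((‖x‖ : ℂ) ^ 2 / (2 * L) * t' * k) * htt
    rw [hbar, h1, hkv, hkv']
    ring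
  have hmu : √(μ / a) = β * μ / L := by
    rw [ha, show μ / (L ^ 2 / (β ^ 2 * μ)) = (β * μ / L) ^ 2 by field_simp]
    exact Real.sqrt_sq (by positivity)
  have hma : √(μ * a) = L / β := by
    rw [ha, show μ * (L ^ 2 / (β ^ 2 * μ)) = (L / β) ^ 2 by field_simp]
    exact Real.sqrt_sq (by positivity)
  have hsq : √L * √(1 - √(1 - e ^ 2)) = ‖x‖ := by
    rw [hroot, ← Real.sqrt_mul hL.le, hq, sub_sub_cancel, mul_div_cancel₀ _ hL.ne',
      Real.sqrt_sq (norm_nonneg x)]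
  have hmap : keplerMap φ β μ v =
      (![I * (momForm φ β μ v x (I * ((l : ℂ) + u)) -
            momForm φ β μ v (I * (-I * (starRingEnd ℂ) x)) (-(I * ((l : ℂ) + u)))) / 2,
         (momForm φ β μ v x (I * ((l : ℂ) + u)) +
            momForm φ β μ v (I * (-I * (starRingEnd ℂ) x)) (-(I * ((l : ℂ) + u)))) / 2],
       ![(posForm β μ v x (I * ((l : ℂ) + u)) +
            posForm β μ v (I * (-I * (starRingEnd ℂ) x)) (-(I * ((l : ℂ) + u)))) / 2,
         (posForm β μ v x (I * ((l : ℂ) + u)) -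
            posForm β μ v (I * (-I * (starRingEnd ℂ) x)) (-(I * ((l : ℂ) + u)))) / (2 * I)]) := by
    simp only [keplerMap, hu]
    rfl
  rw [hA, hB, hV, hW, htv, htv'] at hmap
  refine ⟨_, _, ⟨a, e, w, E, ha0, he0, he1, ?_, ?_, ?_, rfl, rfl⟩, ?_, ?_⟩
  · rw [hma]; field_simp
  · rw [hsq]; exact hxt
  · rw [← hu', hE]; ring
  · rw [hmap, hroot, hmu, ← hd]
    intro i
    fin_cases i
    · simp only [Fin.zero_eta, Matrix.cons_val_zero]
      push_cast
      linear_combination ((β : ℂ) ^ 2 * μ / L / d *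
        (Complex.sin E * Complex.cos w + (1 - q) * Complex.cos E * Complex.sin w)) * I_sq
    · simp only [Fin.mk_one, Matrix.cons_val_one, Matrix.cons_val_fin_one]
      push_cast
      linear_combination ((β : ℂ) ^ 2 * μ / L / d * Complex.sin E * Complex.sin w) * I_sq
  · rw [hmap, hroot]
    intro i
    fin_cases i
    · simp only [Fin.zero_eta, Matrix.cons_val_zero]
      push_cast
      linear_combination (a * (1 - q) * Complex.sin E * Complex.sin w : ℂ) * I_sq
    · simp only [Fin.mk_one, Matrix.cons_val_one, Matrix.cons_val_fin_one]
      push_cast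
      field_simp
      ring

theorem analyticAt_keplerMap {φ : ℂ × ℂ → ℂ} {β μ : ℝ} {v : ℂ × ℂ × ℂ × ℂ}
    (hL : v.2.1 ≠ 0)
    (hslit : (2 - v.2.2.1 * (I * v.2.2.2) / v.2.1) / v.2.1 ∈ slitPlane)
    (hφ : AnalyticAt ℂ φ (eccPos v, eccNeg v))
    (hden : 1 - (eccPos v * exp (I * longDiff φ v) +
      eccNeg v * exp (-(I * longDiff φ v))) / 2 ≠ 0) :
    AnalyticAt ℂ (keplerMap φ β μ) v := by
  have hfac : ContDiffAt ℂ ω eccFactor v := by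
    have h1 : ContDiffAt ℂ ω (fun v : ℂ × ℂ × ℂ × ℂ =>
        (2 - v.2.2.1 * (I * v.2.2.2) / v.2.1) / v.2.1) v := by
      fun_prop (disch := exact hL)
    exact (h1.analyticAt.cpow analyticAt_const hslit).contDiffAt
  have hpos : ContDiffAt ℂ ω eccPos v := by
    unfold eccPos; fun_prop
  have hneg : ContDiffAt ℂ ω eccNeg v := by
    unfold eccNeg; fun_prop
  have hdiff : ContDiffAt ℂ ω (longDiff φ) v :=
    ContDiffAt.comp v hφ.contDiffAt (hpos.prodMk hneg)
  have hA : ∀ y s : ℂ × ℂ × ℂ × ℂ → ℂ, ContDiffAt ℂ ω y v → ContDiffAt ℂ ω s v →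
      ContDiffAt ℂ ω (fun v => posForm β μ v (y v) (s v)) v := by
    intro y s hy hs
    unfold posForm
    have h2L : 2 * v.2.1 ≠ 0 := mul_ne_zero two_ne_zero hL
    fun_prop (disch := assumption)
  have hV : ∀ y s : ℂ × ℂ × ℂ × ℂ → ℂ, ContDiffAt ℂ ω y v → ContDiffAt ℂ ω s v →
      ContDiffAt ℂ ω (fun v => momForm φ β μ v (y v) (s v)) v := by
    intro y s hy hs
    unfold momForm
    have h2L : 2 * v.2.1 ≠ 0 := mul_ne_zero two_ne_zero hL
    fun_prop (disch := assumption)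
  refine ContDiffAt.analyticAt (ContDiffAt.prodMk ?_ ?_)
  · refine contDiffAt_pi.2 fun i => ?_
    fin_cases i
    · exact (contDiffAt_const.mul ((hV _ _ (by fun_prop) (by fun_prop)).sub
        (hV _ _ (by fun_prop) (by fun_prop)))).div_const 2
    · exact ((hV _ _ (by fun_prop) (by fun_prop)).add
        (hV _ _ (by fun_prop) (by fun_prop))).div_const 2
  · refine contDiffAt_pi.2 fun i => ?_
    fin_cases i
    · exact ((hA _ _ (by fun_prop) (by fun_prop)).add
        (hA _ _ (by fun_prop) (by fun_prop))).div_const 2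
    · exact ((hA _ _ (by fun_prop) (by fun_prop)).sub
        (hA _ _ (by fun_prop) (by fun_prop))).div_const (2 * I)

/-- Near a circular orbit of action `L₀` the argument of the square root in `eccFactor` lies in the
right half-plane. -/
theorem eccFactor_arg_mem_slitPlane {L₀ : ℝ} (hL₀ : 0 < L₀) {L q : ℂ} (hL : ‖L - L₀‖ < L₀ / 4)
    (hq : ‖q‖ ≤ 1 / 3) : (2 - q) / L ∈ slitPlane := by
  have h1 := (abs_re_le_norm (L - L₀)).trans hL.le
  have h2 := (abs_im_le_norm (L - L₀)).trans hL.le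
  have h3 := (abs_re_le_norm q).trans hq
  have h4 := (abs_im_le_norm q).trans hq
  simp only [sub_re, ofReal_re, sub_im, ofReal_im, sub_zero, abs_le] at h1 h2 h3 h4
  have hLre : 0 < L.re := by linarith
  have hn : 0 < normSq L := normSq_pos.2 (by rintro rfl; simp at hLre)
  refine Or.inl ?_
  rw [div_re, ← add_div]
  refine div_pos ?_ hn
  simp only [sub_re, sub_im, re_ofNat, im_ofNat]
  have e1 : (5 / 3) * (3 / 4 * L₀) ≤ (2 - q.re) * L.re :=
    mul_le_mul (by linarith) (by linarith) (by linarith) (by linarith)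
  have e2 : |(0 - q.im) * L.im| ≤ 1 / 3 * (L₀ / 4) := by
    rw [abs_mul]
    exact mul_le_mul (abs_le.2 (by constructor <;> linarith)) (abs_le.2 h2) (abs_nonneg _)
      (by norm_num)
  have := (abs_le.1 e2).1
  linarith

theorem norm_keplerMap_le {φ : ℂ × ℂ → ℂ} {β μ B : ℝ} {v : ℂ × ℂ × ℂ × ℂ}
    (h₁ : ‖posForm β μ v v.2.2.1 (I * (v.1 + longDiff φ v))‖ ≤ B)
    (h₂ : ‖posForm β μ v (I * v.2.2.2) (-(I * (v.1 + longDiff φ v)))‖ ≤ B)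
    (h₃ : ‖momForm φ β μ v v.2.2.1 (I * (v.1 + longDiff φ v))‖ ≤ B)
    (h₄ : ‖momForm φ β μ v (I * v.2.2.2) (-(I * (v.1 + longDiff φ v)))‖ ≤ B) :
    ‖keplerMap φ β μ v‖ ≤ B := by
  have hB : 0 ≤ B := (norm_nonneg _).trans h₁
  have hadd : ∀ {a b : ℂ}, ‖a‖ ≤ B → ‖b‖ ≤ B → ‖a + b‖ ≤ B * 2 := fun ha hb =>
    (norm_add_le _ _).trans (by linarith)
  have hsub : ∀ {a b : ℂ}, ‖a‖ ≤ B → ‖b‖ ≤ B → ‖a - b‖ ≤ B * 2 := fun ha hb =>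
    (norm_sub_le _ _).trans (by linarith)
  refine norm_prod_le_iff.2 ⟨(pi_norm_le_iff_of_nonneg hB).2 fun i => ?_,
    (pi_norm_le_iff_of_nonneg hB).2 fun i => ?_⟩ <;> fin_cases i <;>
    simp only [keplerMap, Fin.zero_eta, Fin.mk_one, Matrix.cons_val_zero, Matrix.cons_val_one,
      Matrix.cons_val_fin_one, norm_div, norm_mul, norm_I, norm_ofNat, one_mul, mul_one]
  · exact (div_le_iff₀ two_pos).2 (hsub h₃ h₄)
  · exact (div_le_iff₀ two_pos).2 (hadd h₃ h₄)
  · exact (div_le_iff₀ two_pos).2 (hadd h₁ h₂)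
  · exact (div_le_iff₀ two_pos).2 (hsub h₁ h₂)

theorem eccNeg_eq_conj_eccPos {l L : ℝ} {x : ℂ}
    (hslit : (2 - x * (I * (-I * (starRingEnd ℂ) x)) / (L : ℂ)) / L ∈ slitPlane) :
    eccNeg (l, L, x, -I * (starRingEnd ℂ) x) =
      (starRingEnd ℂ) (eccPos (l, L, x, -I * (starRingEnd ℂ) x)) := by
  have hconj : (starRingEnd ℂ) (eccFactor (l, L, x, -I * (starRingEnd ℂ) x)) =
      eccFactor (l, L, x, -I * (starRingEnd ℂ) x) := by
    have hz : (starRingEnd ℂ) ((2 - x * (I * (-I * (starRingEnd ℂ) x)) / (L : ℂ)) / L) =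
        (2 - x * (I * (-I * (starRingEnd ℂ) x)) / (L : ℂ)) / L := by
      simp only [map_div₀, map_sub, map_mul, map_neg, conj_I, conj_ofReal, Complex.conj_conj,
        map_ofNat]
      ring
    have h := cpow_conj _ (1 / 2 : ℂ) (slitPlane_arg_ne_pi hslit)
    rw [hz, map_div₀, map_one, map_ofNat] at h
    exact h.symm
  simp only [eccNeg, eccPos, map_mul, hconj, ← exp_conj]
  simp only [map_neg, conj_I, conj_ofReal, Complex.conj_conj, neg_mul, neg_neg]
  linear_combination (x * eccFactor (l, L, x, -(I * (starRingEnd ℂ) x)) * exp (-(I * l))) * I_sq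

set_option maxHeartbeats 400000 in
/-- The Kepler maps of all planets with masses, attraction parameters and resonant actions in a
compact range `[k, K]` are holomorphic and bounded on a common neighbourhood of the circular
orbits. -/
theorem exists_kepler_chart {k K : ℝ} (hk : 0 < k) :
    ∃ ρ B : ℝ, 0 < ρ ∧ 0 < B ∧ ∃ Φ : ℝ → ℝ → ℂ × ℂ × ℂ × ℂ → (Fin 2 → ℂ) × (Fin 2 → ℂ),
      ∀ β μ L₀ : ℝ, k ≤ β → β ≤ K → k ≤ μ → μ ≤ K → k ≤ L₀ → L₀ ≤ K →
        (∀ l : ℝ, Φ β μ (l, L₀, 0, 0) =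
          (![((-(β ^ 2 * μ / L₀ * Real.sin l) : ℝ) : ℂ), ((β ^ 2 * μ / L₀ * Real.cos l : ℝ) : ℂ)],
           ![((L₀ ^ 2 / (β ^ 2 * μ) * Real.cos l : ℝ) : ℂ),
             ((L₀ ^ 2 / (β ^ 2 * μ) * Real.sin l : ℝ) : ℂ)])) ∧
        ∀ l L x y : ℂ, |l.im| < 1 → ‖L - L₀‖ < ρ → ‖x‖ < ρ → ‖y‖ < ρ →
          AnalyticAt ℂ (Φ β μ) (l, L, x, y) ∧ ‖Φ β μ (l, L, x, y)‖ ≤ B ∧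
          (l.im = 0 → L.im = 0 → y = -I * (starRingEnd ℂ) x →
            ∃ R r : Fin 2 → ℝ, IsKeplerState β μ l.re L.re x R r ∧
              (∀ i, (Φ β μ (l, L, x, y)).1 i = (R i : ℂ)) ∧
              (∀ i, (Φ β μ (l, L, x, y)).2 i = (r i : ℂ))) := by
  obtain ⟨r, hr, hr4, φ, hφ0, hφ⟩ := exists_kepler_solution
  set S : ℝ := 1 + 4 / k with hS
  have hS0 : 1 ≤ S := by rw [hS]; linarith [div_pos (by norm_num : (0 : ℝ) < 4) hk]
  set E : ℝ := Real.exp 2 with hE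
  have hE0 : 1 ≤ E := Real.one_le_exp (by norm_num)
  set ρ : ℝ := min (min 1 (k / 4)) (r / (S * E)) with hρ
  have hρ0 : 0 < ρ := by positivity
  have hρ1 : ρ ≤ 1 := (min_le_left _ _).trans (min_le_left _ _)
  have hρk : ρ ≤ k / 4 := (min_le_left _ _).trans (min_le_right _ _)
  have hρr : ρ * S * E ≤ r := by
    have : ρ ≤ r / (S * E) := min_le_right _ _
    rw [le_div_iff₀ (by positivity)] at this
    linarith
  set B : ℝ := (K + 1) ^ 2 / (k ^ 2 * k) * (S + 3 * E) + K ^ 2 * K / (3 * k / 4) / (1 / 2) * (3 * E)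
    with hB
  refine ⟨ρ, |B| + 1, hρ0, by positivity, fun β μ => keplerMap φ β μ, ?_⟩
  intro β μ L₀ hβ hβK hμ hμK hL₀ hL₀K
  have hβ0 : 0 < β := hk.trans_le hβ
  have hμ0 : 0 < μ := hk.trans_le hμ
  have hK0 : 0 < K := hβ0.trans_le hβK
  refine ⟨fun l => keplerMap_circular hφ0 β μ l L₀, ?_⟩
  intro l L x y hl hL hx hy
  have hL' : ‖L - L₀‖ < L₀ / 4 := by linarith
  have hnL₀ : ‖(L₀ : ℂ)‖ = L₀ := by rw [norm_real, Real.norm_of_nonneg (by linarith)]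
  have hLlow : 3 * k / 4 ≤ ‖L‖ := by
    have h := norm_sub_norm_le (L₀ : ℂ) (L₀ - L)
    rw [sub_sub_cancel, norm_sub_rev, hnL₀] at h
    linarith
  have hLup : ‖L‖ ≤ K + 1 := by
    have h := norm_add_le (L - L₀) (L₀ : ℂ)
    rw [sub_add_cancel, hnL₀] at h
    linarith
  have hLpos : 0 < ‖L‖ := by linarith
  have hLne : L ≠ 0 := norm_pos_iff.1 hLpos
  have hIy : ‖I * y‖ = ‖y‖ := by simp
  set q : ℂ := x * (I * y) / L with hq
  have hρsq : ρ * ρ ≤ k / 4 := by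
    have := mul_le_mul hρ1 hρk hρ0.le zero_le_one
    rwa [one_mul] at this
  have hq3 : ‖q‖ ≤ 1 / 3 := by
    rw [hq, norm_div, norm_mul, hIy, div_le_iff₀ hLpos]
    have : ‖x‖ * ‖y‖ ≤ ρ * ρ := mul_le_mul hx.le hy.le (norm_nonneg _) hρ0.le
    linarith
  have hslit : (2 - q) / L ∈ slitPlane := eccFactor_arg_mem_slitPlane (by linarith) hL' hq3
  set v : ℂ × ℂ × ℂ × ℂ := (l, L, x, y) with hv
  have hfac : ‖eccFactor v‖ ≤ S := by
    have hsq : eccFactor v ^ 2 = (2 - q) / L := by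
      simp only [eccFactor, hv, ← hq]
      rw [← cpow_nat_mul]; norm_num
    have h1 : ‖eccFactor v‖ ^ 2 ≤ 4 / k := by
      rw [← norm_pow, hsq, norm_div, div_le_div_iff₀ hLpos hk]
      have : ‖2 - q‖ ≤ 2 + 1 / 3 := (norm_sub_le _ _).trans (by simpa using hq3)
      have := mul_le_mul_of_nonneg_right this hk.le
      linarith
    have h2 := sq_nonneg (‖eccFactor v‖ - 1)
    rw [sub_sq] at h2
    linarith [norm_nonneg (eccFactor v)]
  have hexp : ∀ z : ℂ, |z.re| ≤ 2 → ‖exp z‖ ≤ E := by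
    intro z hz
    rw [norm_exp, hE]
    exact Real.exp_le_exp.2 ((le_abs_self _).trans hz)
  have hsmall : ∀ z w : ℂ, ‖z‖ < ρ → |w.re| ≤ 2 → ‖z * eccFactor v * exp w‖ < r := by
    intro z w hz hw
    rw [norm_mul, norm_mul]
    calc ‖z‖ * ‖eccFactor v‖ * ‖exp w‖ ≤ ‖z‖ * S * E := by
          gcongr
          exact hexp w hw
      _ < ρ * S * E := by gcongr
      _ ≤ r := hρr
  have hpos : ‖eccPos v‖ < r := hsmall _ _ (by simpa [hv] using hy) (by
    simp [hv]; linarith)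
  have hneg : ‖eccNeg v‖ < r := hsmall _ _ (by simpa [hv] using hx) (by
    simp [hv]; linarith)
  obtain ⟨hφa, hφn, hφe, hφc⟩ := hφ _ _ hpos hneg
  have hu : |(longDiff φ v).im| ≤ 1 / 2 := (abs_im_le_norm _).trans hφn
  have hhalf : Real.exp (1 / 2) ≤ 2 := by
    have h1 : Real.exp (1 / 2) ^ 2 = Real.exp 1 := by rw [← Real.exp_nat_mul]; norm_num
    have h2 := Real.exp_one_lt_d9
    nlinarith [Real.exp_pos (1 / 2)]
  have hden : ‖(eccPos v * exp (I * longDiff φ v) +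
      eccNeg v * exp (-(I * longDiff φ v))) / 2‖ ≤ 1 / 2 := by
    have h1 : ∀ z : ℂ, |z.re| ≤ 1 / 2 → ‖exp z‖ ≤ 2 := by
      intro z hz
      rw [norm_exp]
      exact (Real.exp_le_exp.2 ((le_abs_self _).trans hz)).trans hhalf
    have h2 : ‖eccPos v * exp (I * longDiff φ v)‖ ≤ 1 / 4 * 2 := by
      rw [norm_mul]
      exact mul_le_mul (hpos.le.trans hr4) (h1 _ (by simpa using hu)) (norm_nonneg _) (by norm_num)
    have h3 : ‖eccNeg v * exp (-(I * longDiff φ v))‖ ≤ 1 / 4 * 2 := by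
      rw [norm_mul]
      exact mul_le_mul (hneg.le.trans hr4) (h1 _ (by simpa using hu)) (norm_nonneg _) (by norm_num)
    rw [norm_div, norm_ofNat, div_le_iff₀ (by norm_num)]
    refine (norm_add_le _ _).trans ?_
    linarith
  set d : ℂ := 1 - (eccPos v * exp (I * longDiff φ v) +
      eccNeg v * exp (-(I * longDiff φ v))) / 2 with hd
  have hdlow : 1 / 2 ≤ ‖d‖ := by
    have := norm_sub_norm_le (1 : ℂ) ((eccPos v * exp (I * longDiff φ v) +
      eccNeg v * exp (-(I * longDiff φ v))) / 2)
    rw [norm_one] at this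
    rw [hd]; linarith
  have hdne : d ≠ 0 := norm_pos_iff.1 (by linarith)
  refine ⟨analyticAt_keplerMap hLne hslit hφa hdne, ?_, ?_⟩
  · -- each of the forms `r₁ ± i r₂`, `R₁ ± i R₂` is bounded by `B`
    have hq1 : ‖1 - q / 2‖ ≤ 2 := by
      refine (norm_sub_le _ _).trans ?_
      rw [norm_one, norm_div, norm_ofNat]; linarith
    have hquad : ∀ z : ℂ, ‖z‖ < ρ → ‖z ^ 2 / (2 * L)‖ ≤ 1 := by
      intro z hz
      rw [norm_div, norm_pow, norm_mul, norm_ofNat, div_le_one (by positivity)]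
      have := pow_le_pow_left₀ (norm_nonneg z) hz.le 2
      linarith [sq ρ]
    have hs : |(I * (l + longDiff φ v)).re| ≤ 2 := by
      have : (I * (l + longDiff φ v)).re = -(l.im + (longDiff φ v).im) := by simp
      rw [this, abs_neg]
      exact (abs_add_le _ _).trans (by linarith)
    have hB1 : (K + 1) ^ 2 / (k ^ 2 * k) * (S + 3 * E) ≤ B := by
      rw [hB]; linarith [show (0 : ℝ) ≤ K ^ 2 * K / (3 * k / 4) / (1 / 2) * (3 * E) by positivity]
    have hB2 : K ^ 2 * K / (3 * k / 4) / (1 / 2) * (3 * E) ≤ B := by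
      rw [hB]; linarith [show (0 : ℝ) ≤ (K + 1) ^ 2 / (k ^ 2 * k) * (S + 3 * E) by positivity]
    have hnβ : ‖(β : ℂ)‖ = β := by rw [norm_real, Real.norm_of_nonneg hβ0.le]
    have hnμ : ‖(μ : ℂ)‖ = μ := by rw [norm_real, Real.norm_of_nonneg hμ0.le]
    have hposB : ∀ z s : ℂ, ‖z‖ < ρ → |s.re| ≤ 2 → ‖posForm β μ v z s‖ ≤ B := by
      intro z s hz hs
      refine le_trans ?_ hB1
      simp only [posForm, ← hq, hv]
      rw [norm_mul, norm_div, norm_mul, norm_pow, norm_pow, hnβ, hnμ]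
      have e1 := hexp s hs
      have e2 := hexp (-s) (by simpa using hs)
      have e3 : ‖z * eccFactor v‖ ≤ 1 * S := by
        rw [norm_mul]
        exact mul_le_mul (hz.le.trans hρ1) hfac (norm_nonneg _) zero_le_one
      have e4 : ‖(1 - q / 2) * exp s‖ ≤ 2 * E := by
        rw [norm_mul]; exact mul_le_mul hq1 e1 (norm_nonneg _) zero_le_two
      have e5 : ‖z ^ 2 / (2 * L) * exp (-s)‖ ≤ 1 * E := by
        rw [norm_mul]; exact mul_le_mul (hquad z hz) e2 (norm_nonneg _) zero_le_one
      refine mul_le_mul ?_ ?_ (norm_nonneg _) (by positivity)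
      · gcongr
      · refine (norm_add₃_le).trans ?_
        rw [norm_neg]
        simp only [hv] at e3
        linarith
    have hmomB : ∀ z s : ℂ, ‖z‖ < ρ → |s.re| ≤ 2 → ‖momForm φ β μ v z s‖ ≤ B := by
      intro z s hz hs
      refine le_trans ?_ hB2
      simp only [momForm, ← hd]
      simp only [hv, ← hq]
      rw [norm_mul, norm_div, norm_div, norm_mul, norm_pow, hnβ, hnμ]
      have e1 := hexp s hs
      have e2 := hexp (-s) (by simpa using hs)
      have e4 : ‖(1 - q / 2) * exp s‖ ≤ 2 * E := by
        rw [norm_mul]; exact mul_le_mul hq1 e1 (norm_nonneg _) zero_le_two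
      have e5 : ‖z ^ 2 / (2 * L) * exp (-s)‖ ≤ 1 * E := by
        rw [norm_mul]; exact mul_le_mul (hquad z hz) e2 (norm_nonneg _) zero_le_one
      refine mul_le_mul ?_ ?_ (norm_nonneg _) (by positivity)
      · gcongr
      · refine (norm_sub_le _ _).trans ?_
        linarith
    have hIy' : ‖I * y‖ < ρ := by rwa [hIy]
    have hs' : |(-(I * (l + longDiff φ v))).re| ≤ 2 := by rwa [neg_re, abs_neg]
    have b1 := hposB x _ hx hs
    have b2 := hposB (I * y) _ hIy' hs'
    have b3 := hmomB x _ hx hs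
    have b4 := hmomB (I * y) _ hIy' hs'
    have hBle : B ≤ |B| + 1 := (le_abs_self B).trans (by linarith)
    exact (norm_keplerMap_le b1 b2 b3 b4).trans hBle
  · intro hl0 hL0 hyx
    obtain ⟨l', rfl⟩ : ∃ l' : ℝ, l = l' := ⟨l.re, Complex.ext (by simp) (by simp [hl0])⟩
    obtain ⟨L', rfl⟩ : ∃ L' : ℝ, L = L' := ⟨L.re, Complex.ext (by simp) (by simp [hL0])⟩
    subst hyx
    have hLL : |L' - L₀| < L₀ / 4 := by
      rwa [← ofReal_sub, norm_real, Real.norm_eq_abs] at hL'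
    have hL'k : 3 * k / 4 < L' := by linarith [(abs_lt.1 hLL).1]
    simp only [ofReal_re]
    refine keplerMap_real hβ0 hμ0 (by linarith) ?_ ⟨hφc (eccNeg_eq_conj_eccPos ?_), hφe⟩
    · have := pow_le_pow_left₀ (norm_nonneg x) hx.le 2
      linarith [sq ρ]
    · simpa [hq] using hslit

/-! ### Bounds uniform in the small parameter -/

theorem redMass_pos {P : Params} (hm₀ : 0 < P.m₀) (hm : ∀ j, 0 < P.m j) {ε : ℝ} (hε : 0 ≤ ε)
    (j : Fin 2) : 0 < redMass P ε j := by
  have := hm j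
  unfold redMass; positivity

theorem gravParam_pos {P : Params} (hG : 0 < P.G) (hm₀ : 0 < P.m₀) (hm : ∀ j, 0 < P.m j) {ε : ℝ}
    (hε : 0 ≤ ε) (j : Fin 2) : 0 < gravParam P ε j := by
  have := hm j
  unfold gravParam; positivity

theorem resAction_pos {P : Params} (hG : 0 < P.G) (hm₀ : 0 < P.m₀) (hω : 0 < P.ω)
    (hm : ∀ j, 0 < P.m j) {ε : ℝ} (hε : 0 ≤ ε) (j : Fin 2) : 0 < resAction P ε j := by
  have h1 := redMass_pos hm₀ hm hε j
  have h2 := gravParam_pos hG hm₀ hm hε j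
  unfold resAction; positivity

theorem resRadius_pos {P : Params} (hG : 0 < P.G) (hm₀ : 0 < P.m₀) (hω : 0 < P.ω)
    (hm : ∀ j, 0 < P.m j) {ε : ℝ} (hε : 0 ≤ ε) (j : Fin 2) : 0 < resRadius P ε j := by
  have h1 := redMass_pos hm₀ hm hε j
  have h2 := gravParam_pos hG hm₀ hm hε j
  have h3 := resAction_pos hG hm₀ hω hm hε j
  unfold resRadius; positivity

theorem resAction_cube {P : Params} (hG : 0 < P.G) (hm₀ : 0 < P.m₀) (hω : 0 < P.ω)
    (hm : ∀ j, 0 < P.m j) {ε : ℝ} (hε : 0 ≤ ε) (j : Fin 2) :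
    resAction P ε j ^ 3 * P.ω = gravParam P ε j ^ 2 * redMass P ε j ^ 3 := by
  have h1 := redMass_pos hm₀ hm hε j
  have h2 := gravParam_pos hG hm₀ hm hε j
  have h : resAction P ε j ^ 3 = gravParam P ε j ^ 2 * redMass P ε j ^ 3 / P.ω := by
    unfold resAction
    rw [← Real.rpow_natCast, ← Real.rpow_mul (by positivity)]
    norm_num
  rw [h, div_mul_cancel₀ _ hω.ne']

theorem exists_two_sided_bound {f : ℝ → ℝ} (hf : ContinuousOn f (Icc 0 1))
    (hpos : ∀ x ∈ Icc (0 : ℝ) 1, 0 < f x) :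
    ∃ K : ℝ, ∀ x ∈ Icc (0 : ℝ) 1, f x ≤ K ∧ (f x)⁻¹ ≤ K := by
  obtain ⟨K₁, h₁⟩ := isCompact_Icc.bddAbove_image hf
  obtain ⟨K₂, h₂⟩ := isCompact_Icc.bddAbove_image (hf.inv₀ fun x hx => (hpos x hx).ne')
  exact ⟨max K₁ K₂, fun x hx => ⟨(h₁ (mem_image_of_mem _ hx)).trans (le_max_left _ _),
    (h₂ (mem_image_of_mem (fun x => (f x)⁻¹) hx)).trans (le_max_right _ _)⟩⟩

/-- The reduced masses, attraction parameters, resonant actions and resonant radii stay in a compact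
subset of `(0, ∞)` as `ε` varies in `(0, 1]`. -/
theorem exists_uniform_bounds {P : Params} (hG : 0 < P.G) (hm₀ : 0 < P.m₀) (hω : 0 < P.ω)
    (hm : ∀ j, 0 < P.m j) :
    ∃ k K : ℝ, 0 < k ∧ ∀ ε : ℝ, 0 ≤ ε → ε ≤ 1 → ∀ j,
      (k ≤ redMass P ε j ∧ redMass P ε j ≤ K) ∧ (k ≤ gravParam P ε j ∧ gravParam P ε j ≤ K) ∧
      (k ≤ resAction P ε j ∧ resAction P ε j ≤ K) ∧
      (k ≤ resRadius P ε j ∧ resRadius P ε j ≤ K) := by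
  have c1 : ∀ j, ContinuousOn (fun ε => redMass P ε j) (Icc 0 1) := by
    intro j
    unfold redMass
    refine ContinuousOn.div (by fun_prop) (by fun_prop) fun x hx => ?_
    have := hm j
    have := hx.1
    positivity
  have c2 : ∀ j, ContinuousOn (fun ε => gravParam P ε j) (Icc 0 1) := by
    intro j
    unfold gravParam
    fun_prop
  have c3 : ∀ j, ContinuousOn (fun ε => resAction P ε j) (Icc 0 1) := by
    intro j
    unfold resAction
    exact ((((c2 j).pow 2).mul ((c1 j).pow 3)).div_const _).rpow_const fun x hx =>
      Or.inr (by norm_num)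
  have c4 : ∀ j, ContinuousOn (fun ε => resRadius P ε j) (Icc 0 1) := by
    intro j
    unfold resRadius
    refine ((c3 j).pow 2).div (((c1 j).pow 2).mul (c2 j)) fun x hx => ?_
    have h1 := redMass_pos hm₀ hm hx.1 j
    have h2 := gravParam_pos hG hm₀ hm hx.1 j
    positivity
  choose K₁ h₁ using fun j => exists_two_sided_bound (c1 j) fun x hx => redMass_pos hm₀ hm hx.1 j
  choose K₂ h₂ using fun j => exists_two_sided_bound (c2 j) fun x hx =>
    gravParam_pos hG hm₀ hm hx.1 j
  choose K₃ h₃ using fun j => exists_two_sided_bound (c3 j) fun x hx =>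
    resAction_pos hG hm₀ hω hm hx.1 j
  choose K₄ h₄ using fun j => exists_two_sided_bound (c4 j) fun x hx =>
    resRadius_pos hG hm₀ hω hm hx.1 j
  obtain ⟨K, hK⟩ := Finite.exists_le fun j => max (max (K₁ j) (K₂ j)) (max (K₃ j) (K₄ j))
  simp only [max_le_iff] at hK
  have hK0 : 0 < K := (redMass_pos hm₀ hm le_rfl 0).trans_le
    ((h₁ 0 0 (by simp)).1.trans (hK 0).1.1)
  refine ⟨K⁻¹, K, by positivity, fun ε h0 h1 j => ?_⟩
  have hmem : ε ∈ Icc (0 : ℝ) 1 := ⟨h0, h1⟩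
  exact
    ⟨⟨inv_le_of_inv_le₀ (redMass_pos hm₀ hm h0 j) ((h₁ j ε hmem).2.trans (hK j).1.1),
        (h₁ j ε hmem).1.trans (hK j).1.1⟩,
      ⟨inv_le_of_inv_le₀ (gravParam_pos hG hm₀ hm h0 j) ((h₂ j ε hmem).2.trans (hK j).1.2),
        (h₂ j ε hmem).1.trans (hK j).1.2⟩,
      ⟨inv_le_of_inv_le₀ (resAction_pos hG hm₀ hω hm h0 j) ((h₃ j ε hmem).2.trans (hK j).2.1),
        (h₃ j ε hmem).1.trans (hK j).2.1⟩,
      ⟨inv_le_of_inv_le₀ (resRadius_pos hG hm₀ hω hm h0 j) ((h₄ j ε hmem).2.trans (hK j).2.2),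
        (h₄ j ε hmem).1.trans (hK j).2.2⟩⟩

/-! ### The Keplerian part -/

theorem norm_prod_zpow_coeff_le {m k : ℕ} (h : m + k ≤ 5) :
    ‖∏ i ∈ Finset.range k, (((-(m : ℤ) : ℤ) : ℂ) - i)‖ ≤ 5 ^ 5 := by
  rw [norm_prod]
  calc ∏ i ∈ Finset.range k, ‖((-(m : ℤ) : ℤ) : ℂ) - i‖ ≤ ∏ _i ∈ Finset.range k, (5 : ℝ) := by
        refine Finset.prod_le_prod (fun _ _ => norm_nonneg _) fun i hi => ?_
        have hi' : i < k := Finset.mem_range.1 hi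
        refine (norm_sub_le _ _).trans ?_
        push_cast
        rw [norm_neg, norm_natCast, norm_natCast]
        exact_mod_cast (by omega : m + i ≤ 5)
    _ = 5 ^ k := by simp
    _ ≤ 5 ^ 5 := pow_le_pow_right₀ (by norm_num) (by omega)

theorem norm_zpow_neg_le {κ : ℝ} (hκ : 0 < κ) (hκ1 : κ ≤ 1) {z : ℂ} (hz : κ ≤ ‖z‖) {n : ℕ}
    (hn : n ≤ 5) : ‖z ^ (-(n : ℤ))‖ ≤ κ⁻¹ ^ 5 := by
  rw [zpow_neg, zpow_natCast, norm_inv, norm_pow, ← inv_pow]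
  exact (pow_le_pow_left₀ (by positivity) (inv_anti₀ hκ hz) n).trans
    (pow_le_pow_right₀ ((one_le_inv₀ hκ).2 hκ1) hn)

theorem iteratedDeriv_zpow_neg (m k : ℕ) :
    iteratedDeriv k (fun x : ℂ => x ^ (-(m : ℤ))) = fun x =>
      (∏ i ∈ Finset.range k, (((-(m : ℤ) : ℤ) : ℂ) - i)) * x ^ (-((m + k : ℕ) : ℤ)) := by
  rw [iteratedDeriv_eq_iterate, iter_deriv_zpow']
  funext x
  congr 2
  push_cast; ring

theorem keplerianBound_of_le {P : Params} {ε k K : ℝ} (hk : 0 < k) (hkL : ∀ j, k ≤ resAction P ε j)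
    (hK : ∀ j, ‖(gravParam P ε j : ℂ) ^ 2 * (redMass P ε j : ℂ) ^ 3‖ ≤ K) {ρ : ℝ} (hρ : ρ ≤ k / 4) :
    KeplerianBound P ε ρ (K * (5 ^ 5 * 5 ^ 5) * (min (k / 2) 1)⁻¹ ^ 5 + 1) := by
  set κ : ℝ := min (k / 2) 1 with hκ
  have hκ0 : 0 < κ := by positivity
  have hκ1 : κ ≤ 1 := min_le_right _ _
  set L₀ : ℂ := (resAction P ε 0 : ℂ) with hL₀
  set L₁ : ℂ := (resAction P ε 1 : ℂ) with hL₁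
  set c₀ : ℂ := (gravParam P ε 0 : ℂ) ^ 2 * (redMass P ε 0 : ℂ) ^ 3 with hc₀
  set c₁ : ℂ := (gravParam P ε 1 : ℂ) ^ 2 * (redMass P ε 1 : ℂ) ^ 3 with hc₁
  have hK0 : 0 ≤ K := (norm_nonneg _).trans (hK 0)
  have hform : ∀ s t : ℂ, keplerian P ε (s, t) =
      -(c₀ / 2) * (s + L₀) ^ (-(2 : ℕ) : ℤ) + -(c₁ / 2) * (t + (L₁ - s)) ^ (-(2 : ℕ) : ℤ) := by
    intro s t
    simp only [keplerian, Fin.sum_univ_two, actions, Matrix.cons_val_zero, Matrix.cons_val_one,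
      Matrix.cons_val_fin_one, ← hc₀, ← hc₁, ← hL₀, ← hL₁, zpow_neg, zpow_natCast]
    rw [add_comm s, show t + (L₁ - s) = L₁ + t - s by ring,
      div_mul_eq_div_div, div_mul_eq_div_div, neg_add]
    simp only [div_eq_mul_inv, neg_mul]
  have hge : ∀ (j : Fin 2) (w : ℂ), ‖w‖ ≤ k / 2 → κ ≤ ‖w + (resAction P ε j : ℂ)‖ := by
    intro j w hw
    have h1 := norm_sub_norm_le (resAction P ε j : ℂ) (-w)
    rw [sub_neg_eq_add, norm_neg, add_comm (resAction P ε j : ℂ), norm_real,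
      Real.norm_of_nonneg (hk.le.trans (hkL j))] at h1
    have h2 : κ ≤ k / 2 := min_le_left _ _
    linarith [hkL j]
  have hge₀ : ∀ s : ℂ, ‖s‖ ≤ ρ → κ ≤ ‖s + L₀‖ := fun s hs => hge 0 s (by linarith)
  have hge₁ : ∀ s t : ℂ, ‖s‖ ≤ ρ → ‖t‖ ≤ ρ → κ ≤ ‖t + (L₁ - s)‖ := by
    intro s t hs ht
    rw [show t + (L₁ - s) = t - s + L₁ by ring]
    exact hge 1 _ ((norm_sub_le _ _).trans (by linarith))
  have hne : ∀ {w : ℂ}, κ ≤ ‖w‖ → w ≠ 0 := fun h => norm_pos_iff.1 (hκ0.trans_le h)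
  refine ⟨?_, ?_⟩
  · rintro ⟨s, t⟩ ⟨hs, ht⟩
    have h0 : s + L₀ ≠ 0 := hne (hge₀ s hs)
    have h1 : t + (L₁ - s) ≠ 0 := hne (hge₁ s t hs ht)
    have : keplerian P ε = fun z => -(c₀ / 2) * ((z.1 + L₀) ^ 2)⁻¹ +
        -(c₁ / 2) * ((z.2 + (L₁ - z.1)) ^ 2)⁻¹ := by
      funext z
      rw [← Prod.mk.eta (p := z), hform, zpow_neg, zpow_neg, zpow_natCast, zpow_natCast]
    rw [this]
    refine ContDiffAt.analyticAt ?_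
    have h0' : (s + L₀) ^ 2 ≠ 0 := pow_ne_zero 2 h0
    have h1' : (t + (L₁ - s)) ^ 2 ≠ 0 := pow_ne_zero 2 h1
    refine (contDiffAt_const.mul (ContDiffAt.inv (n := ω) (f := fun z : ℂ × ℂ => (z.1 + L₀) ^ 2) (by fun_prop) h0')).add
      (contDiffAt_const.mul (ContDiffAt.inv (n := ω)
        (f := fun z : ℂ × ℂ => (z.2 + (L₁ - z.1)) ^ 2) (by fun_prop) h1'))
  · intro a b hab s t hs ht
    -- the term in `t + (L₁ - s)` and, if there is no derivative in `t`, the term in `s + L₀`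
    set p : ℂ := ∏ i ∈ Finset.range b, (((-((2 : ℕ) : ℤ) : ℤ) : ℂ) - i) with hp
    have hp5 : ‖p‖ ≤ 5 ^ 5 := norm_prod_zpow_coeff_le (by omega)
    have hinner : ∀ s : ℂ, iteratedDeriv b (fun t => -(c₁ / 2) * (t + (L₁ - s)) ^ (-(2 : ℕ) : ℤ)) t
        = -(c₁ / 2) * (p * (L₁ + t - s) ^ (-((2 + b : ℕ) : ℤ))) := by
      intro s
      rw [iteratedDeriv_const_mul_field,
        iteratedDeriv_comp_add_const b (fun x : ℂ => x ^ (-(2 : ℕ) : ℤ)), iteratedDeriv_zpow_neg]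
      beta_reduce
      rw [show t + (L₁ - s) = L₁ + t - s by ring]
    set g : ℂ → ℂ := fun s => -(c₁ / 2) * (p * (L₁ + t - s) ^ (-((2 + b : ℕ) : ℤ))) with hg
    have hc : ∀ j, ‖(gravParam P ε j : ℂ) ^ 2 * (redMass P ε j : ℂ) ^ 3 / 2‖ ≤ K / 2 := by
      intro j
      rw [norm_div, norm_ofNat]
      linarith [hK j]
    have hgb : ‖iteratedDeriv a g s‖ ≤ K / 2 * (5 ^ 5 * 5 ^ 5) * κ⁻¹ ^ 5 := by
      rw [hg, iteratedDeriv_const_mul_field, iteratedDeriv_const_mul_field,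
        iteratedDeriv_comp_const_sub a (fun x : ℂ => x ^ (-((2 + b : ℕ) : ℤ))),
        iteratedDeriv_zpow_neg, norm_mul, norm_mul, norm_smul, norm_mul, norm_neg, norm_pow,
        norm_neg, norm_one, one_pow, one_mul, mul_assoc (K / 2), mul_assoc (5 ^ 5 : ℝ)]
      have e1 := hge₁ s t hs ht
      rw [show t + (L₁ - s) = L₁ + t - s by ring] at e1
      have e2 := norm_zpow_neg_le hκ0 hκ1 e1 (show 2 + b + a ≤ 5 by omega)
      have e3 := norm_prod_zpow_coeff_le (show 2 + b + a ≤ 5 by omega)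
      have e4 := hc 1
      gcongr
    have hfb : ‖iteratedDeriv a (fun s => -(c₀ / 2) * (s + L₀) ^ (-(2 : ℕ) : ℤ)) s‖ ≤
        K / 2 * (5 ^ 5 * 5 ^ 5) * κ⁻¹ ^ 5 := by
      rw [iteratedDeriv_const_mul_field,
        iteratedDeriv_comp_add_const a (fun x : ℂ => x ^ (-(2 : ℕ) : ℤ)), iteratedDeriv_zpow_neg,
        norm_mul, norm_mul, norm_neg, mul_assoc (K / 2)]
      have e2 := norm_zpow_neg_le hκ0 hκ1 (hge₀ s hs) (show 2 + a ≤ 5 by omega)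
      have e3 := (norm_prod_zpow_coeff_le (show 2 + a ≤ 5 by omega)).trans
        (by norm_num : (5 : ℝ) ^ 5 ≤ 5 ^ 5 * 5 ^ 5)
      have e4 := hc 0
      gcongr
    simp only [hform]
    rcases Nat.eq_zero_or_pos b with rfl | hb
    · have hfun : (fun s => iteratedDeriv 0 (fun t => -(c₀ / 2) * (s + L₀) ^ (-(2 : ℕ) : ℤ) +
          -(c₁ / 2) * (t + (L₁ - s)) ^ (-(2 : ℕ) : ℤ)) t) =
          (fun s => -(c₀ / 2) * (s + L₀) ^ (-(2 : ℕ) : ℤ)) + g := by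
        funext s
        have := hinner s
        rw [iteratedDeriv_zero] at this
        simp only [iteratedDeriv_zero, Pi.add_apply, hg, this]
      have hz : ∀ (n : ℕ) {w : ℂ → ℂ}, ContDiffAt ℂ a w s → w s ≠ 0 →
          ContDiffAt ℂ a (fun s => w s ^ (-(n : ℤ))) s := by
        intro n w hw h0
        simp only [zpow_neg, zpow_natCast]
        exact (hw.pow n).inv (pow_ne_zero n h0)
      rw [hfun, iteratedDeriv_add]
      · refine (norm_add_le _ _).trans_lt ?_
        linarith
      · exact contDiffAt_const.mul (hz 2 (by fun_prop) (hne (hge₀ s hs)))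
      · refine contDiffAt_const.mul (contDiffAt_const.mul (hz _ (by fun_prop) (hne ?_)))
        rw [show L₁ + t - s = t + (L₁ - s) by ring]
        exact hge₁ s t hs ht
    · have hfun : (fun s => iteratedDeriv b (fun t => -(c₀ / 2) * (s + L₀) ^ (-(2 : ℕ) : ℤ) +
          -(c₁ / 2) * (t + (L₁ - s)) ^ (-(2 : ℕ) : ℤ)) t) = g := by
        funext s
        rw [iteratedDeriv_const_add hb, hinner s]
      rw [hfun]
      have : 0 ≤ K * (5 ^ 5 * 5 ^ 5) * κ⁻¹ ^ 5 := by positivity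
      linarith

/-! ### The circular co-orbital configuration -/

/-- Momenta and positions of two planets on the resonant circular orbits, with `ζ = θ`. -/
def circularState (P : Params) (ε : ℝ) (θ : Fin 2 → ℝ) : State :=
  let b := fun j => redMass P ε j ^ 2 * gravParam P ε j / resAction P ε j
  let l : Fin 2 → ℝ := ![θ 0 + θ 1, θ 1]
  (fun j => ![((-(b j * Real.sin (l j)) : ℝ) : ℂ), ((b j * Real.cos (l j) : ℝ) : ℂ)],
   fun j => ![((resRadius P ε j * Real.cos (l j) : ℝ) : ℂ),
    ((resRadius P ε j * Real.sin (l j) : ℝ) : ℂ)])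

/-- Square of the distance of two points at angle `x` on concentric circles. -/
def chordSq (a₀ a₁ x : ℝ) : ℝ := a₀ ^ 2 + a₁ ^ 2 - 2 * a₀ * a₁ * Real.cos x

theorem cos_le_cos_of_lt_norm {x Δ : ℝ} (hΔ : 0 < Δ)
    (h : Δ < ‖(x : AddCircle (2 * Real.pi))‖) : Real.cos x ≤ Real.cos Δ := by
  have hle := AddCircle.norm_le_half_period (2 * Real.pi) (x := (x : AddCircle (2 * Real.pi)))
    (by positivity)
  rw [abs_of_pos (by positivity), mul_div_cancel_left₀ _ two_ne_zero] at hle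
  rw [AddCircle.norm_eq] at h hle
  rw [← Real.cos_sub_int_mul_two_pi x (round ((2 * Real.pi)⁻¹ * x)), ← Real.cos_abs (x - _)]
  exact Real.cos_le_cos_of_nonneg_of_le_pi hΔ.le hle h.le

theorem minDist_sq_le_chordSq {P : Params} {ε Δ x : ℝ} (h₀ : 0 < resRadius P ε 0)
    (h₁ : 0 < resRadius P ε 1) (hΔ : 0 < Δ) (h : Δ < ‖(x : AddCircle (2 * Real.pi))‖) :
    minDist P ε Δ ^ 2 ≤ chordSq (resRadius P ε 0) (resRadius P ε 1) x := by
  have hc := cos_le_cos_of_lt_norm hΔ h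
  have hs : Real.cos Δ = 1 - 2 * Real.sin (Δ / 2) ^ 2 := by
    rw [← mul_div_cancel₀ Δ (two_ne_zero (α := ℝ)), mul_div_assoc, Real.cos_two_mul,
      Real.cos_sq']
    ring_nf
  unfold minDist chordSq
  set a := resRadius P ε 0
  set b := resRadius P ε 1
  have h1 : min a b * min a b ≤ a * b :=
    mul_le_mul (min_le_left _ _) (min_le_right _ _) (le_min h₀.le h₁.le) h₀.le
  have h2 : min a b * min a b * Real.sin (Δ / 2) ^ 2 ≤ a * b * Real.sin (Δ / 2) ^ 2 :=
    mul_le_mul_of_nonneg_right h1 (sq_nonneg _)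
  have h3 : a * b * Real.cos x ≤ a * b * (1 - 2 * Real.sin (Δ / 2) ^ 2) :=
    mul_le_mul_of_nonneg_left (hc.trans hs.le) (by positivity)
  linarith [sq_nonneg (a - b)]

/-- On circular orbits the indirect part of the perturbation never compensates the direct one. With
`X = a₀² + a₁²` and `y = a₀ a₁ cos x` the crucial inequality is
`27 y² (X - 2 y) ≤ X³`, and `0.55` exceeds the resulting constant `√(8 / 27)`. -/
theorem indirect_le_direct {a₀ a₁ κ x D : ℝ} (h₀ : 0 < a₀) (h₁ : 0 < a₁) (hκ : 0 < κ)
    (hκ₀ : κ ≤ a₀ ^ 3) (hκ₁ : κ ≤ a₁ ^ 3) (hD : 0 < D) (hD2 : D ^ 2 = chordSq a₀ a₁ x) :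
    κ * Real.cos x / (a₀ ^ 2 * a₁ ^ 2) ≤ 0.55 / D := by
  rw [div_le_div_iff₀ (by positivity) hD]
  rcases le_or_gt (Real.cos x) 0 with hc | hc
  · have : κ * Real.cos x * D ≤ 0 :=
      mul_nonpos_of_nonpos_of_nonneg (mul_nonpos_of_nonneg_of_nonpos hκ.le hc) hD.le
    have : 0 ≤ 0.55 * (a₀ ^ 2 * a₁ ^ 2) := by positivity
    linarith
  set c := Real.cos x with hcdef
  have key : 27 * (a₀ * a₁) ^ 2 * (c ^ 2 * D ^ 2) ≤ (a₀ ^ 2 + a₁ ^ 2) ^ 3 := by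
    -- `X³ - 27 X y² + 54 y³ = (X - 3 y)² (X + 6 y)`
    have h : 0 ≤ (a₀ ^ 2 + a₁ ^ 2 - 3 * (a₀ * a₁ * c)) ^ 2 *
        (a₀ ^ 2 + a₁ ^ 2 + 6 * (a₀ * a₁ * c)) := by positivity
    rw [hD2, chordSq, ← hcdef]
    linear_combination h
  have hmass : κ ^ 2 * (a₀ ^ 2 + a₁ ^ 2) ^ 3 ≤ 8 * (a₀ * a₁) ^ 6 := by
    have aux : ∀ a b : ℝ, 0 < a → a ≤ b → κ ≤ a ^ 3 →
        κ ^ 2 * (a ^ 2 + b ^ 2) ^ 3 ≤ 8 * (a * b) ^ 6 := by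
      intro a b ha hab hκa
      calc κ ^ 2 * (a ^ 2 + b ^ 2) ^ 3 ≤ (a ^ 3) ^ 2 * (b ^ 2 + b ^ 2) ^ 3 := by gcongr
        _ = 8 * (a * b) ^ 6 := by ring
    rcases le_total a₀ a₁ with h | h
    · exact aux _ _ h₀ h hκ₀
    · rw [add_comm, mul_comm a₀]
      exact aux _ _ h₁ h hκ₁
  have hsq : 27 * (κ * c * D) ^ 2 ≤ 8 * (a₀ ^ 2 * a₁ ^ 2) ^ 2 := by
    refine le_of_mul_le_mul_left ?_ (show 0 < (a₀ * a₁) ^ 2 by positivity)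
    have := mul_le_mul_of_nonneg_left key (sq_nonneg κ)
    calc (a₀ * a₁) ^ 2 * (27 * (κ * c * D) ^ 2)
        = κ ^ 2 * (27 * (a₀ * a₁) ^ 2 * (c ^ 2 * D ^ 2)) := by ring
      _ ≤ 8 * (a₀ * a₁) ^ 6 := this.trans hmass
      _ = _ := by ring
  refine le_of_sq_le_sq ?_ (by positivity)
  rw [mul_pow 0.55]
  have : 0 ≤ (a₀ ^ 2 * a₁ ^ 2) ^ 2 := sq_nonneg _
  linarith

/-! ### The perturbing part near circular orbits -/

/-- The principal inverse square root of a complex number close to `D²`. -/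
theorem inv_sqrt_estimates {z : ℂ} {D : ℝ} (hD : 0 < D) (h : ‖z - (D : ℂ) ^ 2‖ ≤ 0.4 * D ^ 2) :
    z ∈ slitPlane ∧ 0.8 / D ≤ (1 / z ^ (1 / 2 : ℂ)).re ∧ ‖1 / z ^ (1 / 2 : ℂ)‖ ≤ 2 / D := by
  have hre := (abs_re_le_norm _).trans h
  rw [← ofReal_pow, sub_re, ofReal_re, abs_le] at hre
  have hD2 : 0 < D ^ 2 := by positivity
  have hzre : 0.6 * D ^ 2 ≤ z.re := by linarith [hre.1]
  have hz0 : z ≠ 0 := by rintro rfl; simp at hzre; linarith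
  have hn2 : normSq z ≤ 2 * D ^ 2 * z.re - 0.84 * (D ^ 2) ^ 2 := by
    have h2 := pow_le_pow_left₀ (norm_nonneg _) h 2
    rw [← normSq_eq_norm_sq, normSq_apply, ← ofReal_pow, sub_re, sub_im, ofReal_re, ofReal_im] at h2
    rw [normSq_apply]
    linarith
  set t : ℂ := 1 / z ^ (1 / 2 : ℂ) with ht
  have ht2 : t ^ 2 = z⁻¹ := by
    rw [ht, div_pow, one_pow, ← cpow_nat_mul]
    norm_num
  have htre : 0 < t.re := by
    have harg : |arg z| < Real.pi / 2 := abs_arg_lt_pi_div_two_iff.2 (Or.inl (by linarith))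
    have : t = exp (-(log z * (1 / 2))) := by
      rw [ht, cpow_def_of_ne_zero hz0, exp_neg, one_div]
    rw [this, exp_re]
    refine mul_pos (Real.exp_pos _) (Real.cos_pos_of_mem_Ioo ?_)
    have him : (-(log z * (1 / 2))).im = -(arg z / 2) := by
      rw [neg_im, show (1 / 2 : ℂ) = ((1 / 2 : ℝ) : ℂ) by push_cast; rfl, im_mul_ofReal, log_im]
      ring
    rw [him]
    have := abs_lt.1 harg
    constructor <;> linarith [Real.pi_pos]
  have hzn : 0 < normSq z := normSq_pos.2 hz0
  refine ⟨Or.inl (by linarith), ?_, ?_⟩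
  · have h1 : (t ^ 2).re ≤ t.re ^ 2 := by
      rw [sq, mul_re]; linarith [mul_self_nonneg t.im]
    have h2 : 0.64 / D ^ 2 ≤ (z⁻¹).re := by
      rw [inv_re, div_le_div_iff₀ hD2 hzn]
      have h3 : 0.6 * (D ^ 2 * z.re) ≤ 0.84 * (D ^ 2) ^ 2 := by
        have := mul_le_mul_of_nonneg_left hre.2 hD2.le
        linarith
      have h4 : 0 ≤ D ^ 2 * z.re := mul_nonneg hD2.le (by linarith)
      linarith
    refine le_of_sq_le_sq ?_ htre.le
    rw [div_pow]
    rw [ht2] at h1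
    linarith
  · refine le_of_sq_le_sq ?_ (by positivity)
    rw [← norm_pow, ht2, norm_inv, div_pow, inv_eq_one_div]
    have : z.re ≤ ‖z‖ := re_le_norm z
    rw [div_le_div_iff₀ (norm_pos_iff.2 hz0) hD2]
    linarith

/-- The squared distance of two points in `ℂ²` whose difference is close to a real vector of length
`D`. -/
theorem norm_sum_sq_sub_le {u w : Fin 2 → ℂ} {v : Fin 2 → ℝ} {D : ℝ} (hD : 0 < D)
    (hv : v 0 ^ 2 + v 1 ^ 2 = D ^ 2) (hu : ∀ i, u i = v i + w i) (hw : ∀ i, ‖w i‖ ≤ D / 8) :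
    ‖∑ i, u i ^ 2 - (D : ℂ) ^ 2‖ ≤ 0.4 * D ^ 2 := by
  have hvc : (D : ℂ) ^ 2 = v 0 ^ 2 + v 1 ^ 2 := by exact_mod_cast hv.symm
  have hrw : ∑ i, u i ^ 2 - (D : ℂ) ^ 2 =
      2 * (v 0 * w 0 + v 1 * w 1) + (w 0 ^ 2 + w 1 ^ 2) := by
    rw [Fin.sum_univ_two, hu, hu, hvc]; ring
  have hsum : |v 0| + |v 1| ≤ 1.42 * D := by
    refine le_of_sq_le_sq ?_ (by positivity)
    have := sq_nonneg (|v 0| - |v 1|)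
    have e0 := sq_abs (v 0)
    have e1 := sq_abs (v 1)
    linarith [sq_nonneg D]
  have hlin : ‖(v 0 : ℂ) * w 0 + v 1 * w 1‖ ≤ 1.42 * D * (D / 8) := by
    refine (norm_add_le _ _).trans ?_
    rw [norm_mul, norm_mul, norm_real, norm_real, Real.norm_eq_abs, Real.norm_eq_abs]
    have e0 := mul_le_mul_of_nonneg_left (hw 0) (abs_nonneg (v 0))
    have e1 := mul_le_mul_of_nonneg_left (hw 1) (abs_nonneg (v 1))
    have e2 := mul_le_mul_of_nonneg_right hsum (show 0 ≤ D / 8 by positivity)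
    linarith
  have hquad : ∀ i, ‖w i ^ 2‖ ≤ (D / 8) ^ 2 := fun i => by
    rw [norm_pow]; exact pow_le_pow_left₀ (norm_nonneg _) (hw i) 2
  rw [hrw]
  refine (norm_add_le _ _).trans ?_
  rw [norm_mul, norm_ofNat]
  have := norm_add_le (w 0 ^ 2) (w 1 ^ 2)
  linarith [hquad 0, hquad 1, sq_nonneg D]

theorem norm_mom_apply_le (s : State) (j i : Fin 2) : ‖s.1 j i‖ ≤ ‖s‖ :=
  (norm_le_pi_norm (s.1 j) i).trans ((norm_le_pi_norm s.1 j).trans (norm_fst_le s))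

theorem norm_pos_apply_le (s : State) (j i : Fin 2) : ‖s.2 j i‖ ≤ ‖s‖ :=
  (norm_le_pi_norm (s.2 j) i).trans ((norm_le_pi_norm s.2 j).trans (norm_snd_le s))

theorem norm_momProd_sub_le {s s₀ : State} {B e : ℝ} (hs : ‖s‖ ≤ B) (hs₀ : ‖s₀‖ ≤ B)
    (he : ‖s - s₀‖ ≤ e) :
    ‖∑ i, s.1 0 i * s.1 1 i - ∑ i, s₀.1 0 i * s₀.1 1 i‖ ≤ 4 * B * e := by
  have hB : 0 ≤ B := (norm_nonneg _).trans hs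
  have hterm : ∀ i, ‖s.1 0 i * s.1 1 i - s₀.1 0 i * s₀.1 1 i‖ ≤ 2 * B * e := by
    intro i
    have hrw : s.1 0 i * s.1 1 i - s₀.1 0 i * s₀.1 1 i =
        (s - s₀).1 0 i * s.1 1 i + s₀.1 0 i * (s - s₀).1 1 i := by
      simp only [Prod.fst_sub, Pi.sub_apply]; ring
    rw [hrw]
    refine (norm_add_le _ _).trans ?_
    rw [norm_mul, norm_mul]
    have e1 := mul_le_mul ((norm_mom_apply_le (s - s₀) 0 i).trans he) ((norm_mom_apply_le s 1 i).trans hs)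
      (norm_nonneg _) ((norm_nonneg _).trans he)
    have e2 := mul_le_mul ((norm_mom_apply_le s₀ 0 i).trans hs₀) ((norm_mom_apply_le (s - s₀) 1 i).trans he)
      (norm_nonneg _) hB
    linarith
  rw [← Finset.sum_sub_distrib, Fin.sum_univ_two]
  refine (norm_add_le _ _).trans ?_
  linarith [hterm 0, hterm 1]

/-- `R₁ · R₂ = (G m₁ m₂) m₀ κ cos θ₁ / (a₁ a₂)²` on circular orbits, where `κ = G m₀ / ω²` is the
cube of the orbital radius of a massless body. -/
theorem circularState_momProd {P : Params} (hG : 0 < P.G) (hm₀ : 0 < P.m₀) (hω : 0 < P.ω)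
    (hm : ∀ j, 0 < P.m j) {ε : ℝ} (hε : 0 ≤ ε) (θ : Fin 2 → ℝ) :
    ∑ i, (circularState P ε θ).1 0 i * (circularState P ε θ).1 1 i =
      ((P.G * P.m 0 * P.m 1 * P.m₀ * (P.G * P.m₀ / P.ω ^ 2 * Real.cos (θ 0) /
        (resRadius P ε 0 ^ 2 * resRadius P ε 1 ^ 2)) : ℝ) : ℂ) := by
  have hb : ∀ j, redMass P ε j ^ 2 * gravParam P ε j / resAction P ε j =
      P.G * P.m₀ * P.m j / P.ω / resRadius P ε j ^ 2 := by
    intro j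
    have h1 := redMass_pos hm₀ hm hε j
    have h2 := gravParam_pos hG hm₀ hm hε j
    have h3 := resAction_pos hG hm₀ hω hm hε j
    have h4 := resAction_cube hG hm₀ hω hm hε j
    have h5 : P.G * P.m₀ * P.m j = redMass P ε j * gravParam P ε j := by
      have := hm j
      unfold redMass gravParam
      field_simp
    rw [h5, resRadius]
    field_simp
    linear_combination h4
  have hcos : Real.cos (θ 0) = Real.cos (θ 0 + θ 1) * Real.cos (θ 1) +
      Real.sin (θ 0 + θ 1) * Real.sin (θ 1) := by
    rw [← Real.cos_sub, add_sub_cancel_right]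
  simp only [circularState, Fin.sum_univ_two, Matrix.cons_val_zero, Matrix.cons_val_one,
    Matrix.cons_val_fin_one, hb]
  rw [hcos, ← ofReal_mul, ← ofReal_mul, ← ofReal_add]
  congr 1
  have h0 := resRadius_pos hG hm₀ hω hm hε 0
  have h1 := resRadius_pos hG hm₀ hω hm hε 1
  field_simp
  ring

/-- Kepler's third law `ω² a_j³ = μ_j` gives `G m₀ / ω² ≤ a_j³`. -/
theorem le_resRadius_cube {P : Params} (hG : 0 < P.G) (hm₀ : 0 < P.m₀) (hω : 0 < P.ω)
    (hm : ∀ j, 0 < P.m j) {ε : ℝ} (hε : 0 ≤ ε) (j : Fin 2) :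
    P.G * P.m₀ / P.ω ^ 2 ≤ resRadius P ε j ^ 3 := by
  have h1 := redMass_pos hm₀ hm hε j
  have h2 := gravParam_pos hG hm₀ hm hε j
  have h4 := resAction_cube hG hm₀ hω hm hε j
  have h5 : resRadius P ε j ^ 3 = gravParam P ε j / P.ω ^ 2 := by
    rw [resRadius, div_pow, div_eq_div_iff (by positivity) (by positivity)]
    linear_combination (resAction P ε j ^ 3 * P.ω +
      gravParam P ε j ^ 2 * redMass P ε j ^ 3) * h4
  rw [h5]
  have := hm j
  unfold gravParam
  gcongr
  have : 0 ≤ ε * P.m j := by positivity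
  linarith

/-- The estimates for a state close to a circular one: the closeness is relative to the mutual
distance `D` in the positions, and absolute in the momenta. Of the margin `(0.8 - 0.55) / D`, which
is at least `0.125 / K`, the change of the momenta may use up `0.05 / K`. -/
theorem perturbation_estimates {P : Params} (hG : 0 < P.G) (hm₀ : 0 < P.m₀) (hω : 0 < P.ω)
    (hm : ∀ j, 0 < P.m j) {ε : ℝ} (hε : 0 ≤ ε) {θ : Fin 2 → ℝ} {s : State} {B K e D : ℝ}
    (hs : ‖s‖ ≤ B) (hs₀ : ‖circularState P ε θ‖ ≤ B) (hK : ∀ j, resRadius P ε j ≤ K) (hD : 0 < D)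
    (hD2 : D ^ 2 = chordSq (resRadius P ε 0) (resRadius P ε 1) (θ 0))
    (he : ‖s - circularState P ε θ‖ ≤ e) (heD : ‖s - circularState P ε θ‖ ≤ D / 16)
    (heB : 4 * B * e ≤ 0.05 * (P.G * P.m 0 * P.m 1 * P.m₀) / K) :
    D / 2 ≤ hermDist s ∧ distSq s ∈ slitPlane ∧
      ε * (0.05 * (P.G * P.m 0 * P.m 1) / K) ≤ ‖perturbation P ε s‖ ∧
      ‖perturbation P ε s‖ ≤ ε * (2 * B ^ 2 / P.m₀ + P.G * P.m 0 * P.m 1 * (2 / D)) := by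
  have ha₀ := resRadius_pos hG hm₀ hω hm hε 0
  have ha₁ := resRadius_pos hG hm₀ hω hm hε 1
  have hK0 : 0 < K := ha₀.trans_le (hK 0)
  have hm0 := hm 0
  have hm1 := hm 1
  set s₀ := circularState P ε θ with hs₀def
  set g : ℝ := P.G * P.m 0 * P.m 1 with hg
  have hg0 : 0 < g := by positivity
  have hdist : ‖distSq s - (D : ℂ) ^ 2‖ ≤ 0.4 * D ^ 2 := by
    refine norm_sum_sq_sub_le (u := fun i => s.2 0 i - s.2 1 i)
      (w := fun i => (s - s₀).2 0 i - (s - s₀).2 1 i)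
      (v := ![resRadius P ε 0 * Real.cos (θ 0 + θ 1) - resRadius P ε 1 * Real.cos (θ 1),
        resRadius P ε 0 * Real.sin (θ 0 + θ 1) - resRadius P ε 1 * Real.sin (θ 1)])
      hD ?_ ?_ ?_
    · have hcos : Real.cos (θ 0) = Real.cos (θ 0 + θ 1) * Real.cos (θ 1) +
          Real.sin (θ 0 + θ 1) * Real.sin (θ 1) := by
        rw [← Real.cos_sub, add_sub_cancel_right]
      rw [hD2, chordSq, hcos]
      simp only [Matrix.cons_val_zero, Matrix.cons_val_one, Matrix.cons_val_fin_one]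
      linear_combination resRadius P ε 0 ^ 2 * Real.sin_sq_add_cos_sq (θ 0 + θ 1) +
        resRadius P ε 1 ^ 2 * Real.sin_sq_add_cos_sq (θ 1)
    · intro i
      fin_cases i <;> simp [hs₀def, circularState] <;> ring
    · intro i
      refine (norm_sub_le _ _).trans ?_
      linarith [norm_pos_apply_le (s - s₀) 0 i, norm_pos_apply_le (s - s₀) 1 i]
  obtain ⟨hslit, hre, hnorm⟩ := inv_sqrt_estimates hD hdist
  set t : ℂ := 1 / distSq s ^ (1 / 2 : ℂ) with ht
  have hpert : perturbation P ε s = ε * ((∑ i, s.1 0 i * s.1 1 i) / (P.m₀ : ℂ) - (g : ℂ) * t) := by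
    simp only [perturbation, ht, hg]
    push_cast
    rw [mul_one_div]
  have hεn : ‖(ε : ℂ)‖ = ε := by rw [norm_real, Real.norm_of_nonneg hε]
  have hm₀n : ‖(P.m₀ : ℂ)‖ = P.m₀ := by rw [norm_real, Real.norm_of_nonneg hm₀.le]
  have hgn : ‖(g : ℂ)‖ = g := by rw [norm_real, Real.norm_of_nonneg hg0.le]
  refine ⟨?_, hslit, ?_, ?_⟩
  · refine Real.le_sqrt_of_sq_le ?_
    have h1 : ‖distSq s‖ ≤ ∑ i, ‖s.2 0 i - s.2 1 i‖ ^ 2 := by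
      refine (norm_sum_le _ _).trans (Finset.sum_le_sum fun i _ => ?_)
      rw [norm_pow]
    have h2 := norm_sub_norm_le ((D : ℂ) ^ 2) ((D : ℂ) ^ 2 - distSq s)
    rw [sub_sub_cancel, norm_sub_rev, norm_pow, norm_real, Real.norm_of_nonneg hD.le] at h2
    linarith [sq_nonneg D]
  · rw [hpert, norm_mul, hεn]
    refine mul_le_mul_of_nonneg_left ?_ hε
    rw [← norm_neg]
    refine le_trans ?_ (re_le_norm _)
    set S : ℂ := ∑ i, s.1 0 i * s.1 1 i with hS
    have hprod := norm_momProd_sub_le hs hs₀ he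
    rw [circularState_momProd hG hm₀ hω hm hε] at hprod
    have hSre := (re_le_norm _).trans hprod
    rw [← hS, sub_re, ofReal_re] at hSre
    have hcirc := indirect_le_direct (κ := P.G * P.m₀ / P.ω ^ 2) ha₀ ha₁ (by positivity)
      (le_resRadius_cube hG hm₀ hω hm hε 0) (le_resRadius_cube hG hm₀ hω hm hε 1) hD hD2
    have hSle : S.re / P.m₀ ≤ g * (0.55 / D) + 0.05 * g / K := by
      rw [div_le_iff₀ hm₀]
      have h1 := mul_le_mul_of_nonneg_left hcirc (show 0 ≤ g * P.m₀ by positivity)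
      have h2 : (g * (0.55 / D) + 0.05 * g / K) * P.m₀ =
          g * P.m₀ * (0.55 / D) + 0.05 * (g * P.m₀) / K := by ring
      rw [h2]
      linarith
    have hD2K : D ≤ 2 * K := by
      refine le_of_sq_le_sq ?_ (by positivity)
      rw [hD2, chordSq]
      have h1 := Real.neg_one_le_cos (θ 0)
      have h2 := mul_le_mul_of_nonneg_left h1 (show 0 ≤ 2 * resRadius P ε 0 * resRadius P ε 1 by
        positivity)
      have h3 := pow_le_pow_left₀ (by positivity) (add_le_add (hK 0) (hK 1)) 2
      linarith
    have hDK : 0.1 / K ≤ 0.2 / D := by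
      rw [div_le_div_iff₀ hK0 hD]; linarith
    have h3 : (-(S / (P.m₀ : ℂ) - (g : ℂ) * t)).re = g * t.re - S.re / P.m₀ := by
      rw [neg_re, sub_re, div_ofReal_re, re_ofReal_mul]; ring
    rw [h3]
    have h4 := mul_le_mul_of_nonneg_left hre hg0.le
    have h5 := mul_le_mul_of_nonneg_left hDK hg0.le
    have h6 : 0.05 * g / K = g * (0.1 / K) / 2 := by ring
    have h7 : g * (0.8 / D) = g * (0.55 / D) + 1.25 * (g * (0.2 / D)) := by ring
    have h8 : 0 ≤ g * (0.2 / D) := by positivity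
    linarith
  · rw [hpert, norm_mul, hεn]
    refine mul_le_mul_of_nonneg_left ((norm_sub_le _ _).trans (add_le_add ?_ ?_)) hε
    · rw [norm_div, hm₀n]
      refine div_le_div_of_nonneg_right ?_ hm₀.le
      rw [Fin.sum_univ_two]
      refine (norm_add_le _ _).trans ?_
      rw [norm_mul, norm_mul]
      have hB : 0 ≤ B := (norm_nonneg _).trans hs
      have e0 := mul_le_mul ((norm_mom_apply_le s 0 0).trans hs) ((norm_mom_apply_le s 1 0).trans hs)
        (norm_nonneg _) hB
      have e1 := mul_le_mul ((norm_mom_apply_le s 0 1).trans hs) ((norm_mom_apply_le s 1 1).trans hs)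
        (norm_nonneg _) hB
      linarith
    · rw [norm_mul, hgn]
      exact mul_le_mul_of_nonneg_left hnorm hg0.le

/-! ### The holomorphic extension and its derivative -/

theorem exists_extension {P : Params} (hG : 0 < P.G) (hm₀ : 0 < P.m₀) (hω : 0 < P.ω)
    (hm : ∀ j, 0 < P.m j) :
    ∃ r B : ℝ, 0 < r ∧ 0 < B ∧ ∀ ε : ℝ, 0 ≤ ε → ε ≤ 1 → ∃ U : Coords → State,
      (∀ θ : Fin 2 → ℝ, U (fun j => (θ j : ℂ), 0, 0, 0) = circularState P ε θ) ∧
      ∀ p : Coords, (∀ j, |(Coords.ζ p j).im| < 1 / 2 ∧ ‖Coords.Z p j‖ < r ∧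
          ‖Coords.ξ p j‖ < r ∧ ‖Coords.η p j‖ < r) →
        AnalyticAt ℂ U p ∧ ‖U p‖ ≤ B ∧
        (IsRealPoint p → ∀ j, ∃ R r : Fin 2 → ℝ,
          IsKeplerState (redMass P ε j) (gravParam P ε j) (meanLong p j).re
            (actions P ε (Coords.Z p) j).re (Coords.ξ p j) R r ∧
          (∀ i, (U p).1 j i = (R i : ℂ)) ∧ (∀ i, (U p).2 j i = (r i : ℂ))) := by
  obtain ⟨k, K, hk, hkK⟩ := exists_uniform_bounds hG hm₀ hω hm
  obtain ⟨ρ, B, hρ, hB, Φ, hΦ⟩ := exists_kepler_chart (K := K) hk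
  refine ⟨ρ / 2, B, by positivity, hB, fun ε hε hε1 => ?_⟩
  have hchart := fun j => hΦ (redMass P ε j) (gravParam P ε j) (resAction P ε j)
    (hkK ε hε hε1 j).1.1 (hkK ε hε hε1 j).1.2 (hkK ε hε hε1 j).2.1.1 (hkK ε hε hε1 j).2.1.2
    (hkK ε hε hε1 j).2.2.1.1 (hkK ε hε hε1 j).2.2.1.2
  let χ : Fin 2 → Coords → ℂ × ℂ × ℂ × ℂ := fun j p =>
    (meanLong p j, actions P ε (Coords.Z p) j, Coords.ξ p j, Coords.η p j)
  refine ⟨fun p => (fun j => (Φ (redMass P ε j) (gravParam P ε j) (χ j p)).1,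
    fun j => (Φ (redMass P ε j) (gravParam P ε j) (χ j p)).2), ?_, ?_⟩
  · intro θ
    have hχ : ∀ j, χ j (fun j => (θ j : ℂ), 0, 0, 0) =
        (((![θ 0 + θ 1, θ 1] : Fin 2 → ℝ) j : ℂ), (resAction P ε j : ℂ), 0, 0) := by
      intro j
      fin_cases j <;> simp [χ, meanLong, actions, Coords.ζ, Coords.Z, Coords.ξ, Coords.η]
    simp only [hχ, (hchart _).1]
    rfl
  · intro p hp
    have hl : ∀ j, |(meanLong p j).im| < 1 := by
      intro j
      have h0 := (hp 0).1
      have h1 := (hp 1).1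
      fin_cases j
      · simp only [meanLong, Fin.zero_eta, Matrix.cons_val_zero, add_im]
        exact (abs_add_le _ _).trans_lt (by linarith)
      · simp only [meanLong, Fin.mk_one, Matrix.cons_val_one, Matrix.cons_val_fin_one]
        linarith
    have hL : ∀ j, ‖actions P ε (Coords.Z p) j - resAction P ε j‖ < ρ := by
      intro j
      have h0 := (hp 0).2.1
      have h1 := (hp 1).2.1
      fin_cases j
      · simp only [actions, Fin.zero_eta, Matrix.cons_val_zero, add_sub_cancel_left]
        linarith
      · simp only [actions, Fin.mk_one, Matrix.cons_val_one, Matrix.cons_val_fin_one]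
        rw [add_sub_assoc, add_sub_cancel_left]
        exact (norm_sub_le _ _).trans_lt (by linarith)
    have hloc := fun j => (hchart j).2 (meanLong p j) (actions P ε (Coords.Z p) j) (Coords.ξ p j)
      (Coords.η p j) (hl j) (hL j) ((hp j).2.2.1.trans (by linarith))
      ((hp j).2.2.2.trans (by linarith))
    have hχ : ∀ j, ContDiffAt ℂ ω (χ j) p := by
      intro j
      have h1 : ContDiffAt ℂ ω (fun p : Coords => meanLong p j) p := by
        fin_cases j
        · simp only [meanLong, Coords.ζ, Fin.zero_eta, Matrix.cons_val_zero]; fun_prop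
        · simp only [meanLong, Coords.ζ, Fin.mk_one, Matrix.cons_val_one,
            Matrix.cons_val_fin_one]; fun_prop
      have h2 : ContDiffAt ℂ ω (fun p : Coords => actions P ε (Coords.Z p) j) p := by
        fin_cases j
        · simp only [actions, Coords.Z, Fin.zero_eta, Matrix.cons_val_zero]; fun_prop
        · simp only [actions, Coords.Z, Fin.mk_one, Matrix.cons_val_one,
            Matrix.cons_val_fin_one]; fun_prop
      have h3 : ContDiffAt ℂ ω (fun p : Coords => Coords.ξ p j) p := by
        simp only [Coords.ξ]; fun_prop
      have h4 : ContDiffAt ℂ ω (fun p : Coords => Coords.η p j) p := by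
        simp only [Coords.η]; fun_prop
      exact h1.prodMk (h2.prodMk (h3.prodMk h4))
    have hΦχ : ∀ j, ContDiffAt ℂ ω
        (fun p => Φ (redMass P ε j) (gravParam P ε j) (χ j p)) p := fun j =>
      ContDiffAt.comp p (hloc j).1.contDiffAt (hχ j)
    refine ⟨ContDiffAt.analyticAt ((contDiffAt_pi.2 fun j => (hΦχ j).fst).prodMk
      (contDiffAt_pi.2 fun j => (hΦχ j).snd)), ?_, ?_⟩
    · refine norm_prod_le_iff.2 ⟨(pi_norm_le_iff_of_nonneg hB.le).2 fun j => ?_,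
        (pi_norm_le_iff_of_nonneg hB.le).2 fun j => ?_⟩
      · exact (norm_fst_le _).trans (hloc j).2.1
      · exact (norm_snd_le _).trans (hloc j).2.1
    · intro hreal j
      refine (hloc j).2.2 ?_ ?_ (hreal j).2.2
      · have h0 := (hreal 0).1
        have h1 := (hreal 1).1
        fin_cases j <;> simp [meanLong, h0, h1]
      · have h0 := (hreal 0).2.1
        have h1 := (hreal 1).2.1
        fin_cases j <;> simp [actions, h0, h1]

/-- Cauchy's estimate for the Fréchet derivative. -/
theorem norm_fderiv_le_of_closedBall {E F : Type*} [NormedAddCommGroup E] [NormedSpace ℂ E]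
    [NormedAddCommGroup F] [NormedSpace ℂ F] {f : E → F} {p : E} {s B : ℝ} (hs : 0 < s)
    (hB : 0 ≤ B) (hd : ∀ x ∈ Metric.closedBall p s, DifferentiableAt ℂ f x)
    (hf : ∀ x ∈ Metric.closedBall p s, ‖f x‖ ≤ B) : ‖fderiv ℂ f p‖ ≤ B / s := by
  refine ContinuousLinearMap.opNorm_le_bound _ (by positivity) fun v => ?_
  rcases eq_or_ne v 0 with rfl | hv
  · simp
  have hv' : 0 < ‖v‖ := norm_pos_iff.2 hv
  let g : ℂ → F := fun t => f (p + t • v)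
  have hmem : ∀ t ∈ Metric.closedBall (0 : ℂ) (s / ‖v‖), p + t • v ∈ Metric.closedBall p s := by
    intro t ht
    rw [mem_closedBall_zero_iff, le_div_iff₀ hv'] at ht
    rwa [mem_closedBall_iff_norm, add_sub_cancel_left, norm_smul]
  have hline : ∀ t : ℂ, HasDerivAt (fun t : ℂ => p + t • v) v t := fun t => by
    simpa using ((hasDerivAt_id t).smul_const v).const_add p
  have hg : ∀ t ∈ Metric.closedBall (0 : ℂ) (s / ‖v‖), DifferentiableAt ℂ g t := fun t ht =>
    (hd _ (hmem t ht)).comp t (hline t).differentiableAt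
  have hcl : DiffContOnCl ℂ g (Metric.ball 0 (s / ‖v‖)) :=
    DifferentiableOn.diffContOnCl fun t ht =>
      (hg t (Metric.closure_ball_subset_closedBall ht)).differentiableWithinAt
  have hderiv : deriv g 0 = fderiv ℂ f p v := by
    have h1 : HasFDerivAt f (fderiv ℂ f p) (p + (0 : ℂ) • v) := by
      rw [zero_smul, add_zero]
      exact (hd p (Metric.mem_closedBall_self hs.le)).hasFDerivAt
    exact (h1.comp_hasDerivAt 0 (hline 0)).deriv
  have h := norm_deriv_le_of_forall_mem_sphere_norm_le (div_pos hs hv') hcl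
    fun t ht => hf _ (hmem t (Metric.sphere_subset_closedBall ht))
  rw [hderiv] at h
  refine h.trans (le_of_eq ?_)
  field_simp

/-! ### Geometry of the complex domain -/

theorem dom_mono {Δ ρ σ ρ' σ' : ℝ} (hσ0 : 0 ≤ σ) (hρ0' : 0 ≤ ρ') (hρ : ρ ≤ ρ') (hσ : σ ≤ σ') :
    dom Δ ρ σ ⊆ dom Δ ρ' σ' := by
  intro p hp
  have h : √(ρ * σ) ≤ √(ρ' * σ') := Real.sqrt_le_sqrt (mul_le_mul hρ hσ hσ0 hρ0')
  exact ⟨hp.1, fun j => ⟨(hp.2 j).1.trans hρ, (hp.2 j).2.1.trans h, (hp.2 j).2.2.1.trans h,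
    (hp.2 j).2.2.2.trans hσ⟩⟩

/-- The real circular point below a point of the complex domain. -/
def circularPoint (p : Coords) : Coords := (fun j => (((Coords.ζ p j).re : ℝ) : ℂ), 0, 0, 0)

theorem segment_circularPoint_subset_dom {Δ ρ σ : ℝ} {p : Coords} (hp : p ∈ dom Δ ρ σ) :
    segment ℝ (circularPoint p) p ⊆ dom Δ ρ σ := by
  rintro _ ⟨a, b, ha, hb, hab, rfl⟩
  have hb1 : b ≤ 1 := by linarith
  have hshrink : ∀ z : ℂ, ‖(b : ℂ) * z‖ ≤ ‖z‖ := fun z => by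
    rw [norm_mul, norm_real, Real.norm_of_nonneg hb]
    exact mul_le_of_le_one_left (norm_nonneg z) hb1
  refine ⟨?_, fun j => ?_⟩
  · have : (Coords.ζ (a • circularPoint p + b • p) 0).re = (Coords.ζ p 0).re := by
      simp [Coords.ζ, circularPoint, ← add_mul, hab]
    rw [this]
    exact hp.1
  · obtain ⟨h1, h2, h3, h4⟩ := hp.2 j
    refine ⟨?_, ?_, ?_, ?_⟩
    · simpa [Coords.Z, circularPoint] using (hshrink _).trans h1
    · simpa [Coords.ξ, circularPoint] using (hshrink _).trans h2
    · simpa [Coords.η, circularPoint] using (hshrink _).trans h3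
    · have : (Coords.ζ (a • circularPoint p + b • p) j).im = b * (Coords.ζ p j).im := by
        simp [Coords.ζ, circularPoint]
      rw [this, abs_mul, abs_of_nonneg hb]
      exact (mul_le_of_le_one_left (abs_nonneg _) hb1).trans h4

theorem norm_sub_circularPoint_le {Δ ρ σ : ℝ} {p : Coords} (hp : p ∈ dom Δ ρ σ) (hσ : 0 ≤ σ)
    (hρσ : ρ ≤ σ) : ‖p - circularPoint p‖ ≤ σ := by
  have hs : √(ρ * σ) ≤ σ := by
    rw [Real.sqrt_le_left hσ, sq]
    exact mul_le_mul_of_nonneg_right hρσ hσ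
  refine norm_prod_le_iff.2 ⟨?_, norm_prod_le_iff.2 ⟨?_, norm_prod_le_iff.2 ⟨?_, ?_⟩⟩⟩ <;>
    refine (pi_norm_le_iff_of_nonneg hσ).2 fun j => ?_
  · have : (p - circularPoint p).1 j = ((Coords.ζ p j).im : ℂ) * I := by
      apply Complex.ext <;> simp [Coords.ζ, circularPoint]
    rw [this, norm_mul, norm_I, mul_one, norm_real]
    exact (hp.2 j).2.2.2
  · simpa [circularPoint, Coords.Z] using (hp.2 j).1.trans hρσ
  · simpa [circularPoint, Coords.ξ] using (hp.2 j).2.1.trans hs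
  · simpa [circularPoint, Coords.η] using (hp.2 j).2.2.1.trans hs

theorem dom_nonempty {Δ ρ σ : ℝ} (hΔ : Δ < Real.pi) (hρ : 0 ≤ ρ) (hσ : 0 ≤ σ) :
    (dom Δ ρ σ).Nonempty := by
  refine ⟨(fun _ => ((Real.pi : ℝ) : ℂ), 0, 0, 0), ?_, fun j => ?_⟩
  · have h := AddCircle.norm_half_period_eq (2 * Real.pi)
    rw [mul_div_cancel_left₀ _ two_ne_zero, abs_of_pos (by positivity),
      mul_div_cancel_left₀ _ two_ne_zero] at h
    simpa [Coords.ζ, h] using hΔ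
  · simpa [Coords.Z, Coords.ξ, Coords.η, Coords.ζ, hρ, hσ] using
      mul_nonneg (Real.sqrt_nonneg ρ) (Real.sqrt_nonneg σ)

theorem minDist_pos {P : Params} {ε Δ : ℝ} (h₀ : 0 < resRadius P ε 0) (h₁ : 0 < resRadius P ε 1)
    (hΔ : 0 < Δ) (hΔπ : Δ < Real.pi) : 0 < minDist P ε Δ := by
  have := Real.sin_pos_of_pos_of_lt_pi (half_pos hΔ) (by linarith)
  have := lt_min h₀ h₁
  unfold minDist
  positivity

theorem analyticAt_perturbation {P : Params} {ε : ℝ} {s : State} (hs : distSq s ∈ slitPlane) :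
    AnalyticAt ℂ (perturbation P ε) s := by
  have h1 : AnalyticAt ℂ distSq s := by
    refine ContDiffAt.analyticAt ?_
    unfold distSq; fun_prop
  have h2 : ContDiffAt ℂ ω (fun s => distSq s ^ (1 / 2 : ℂ)) s :=
    (h1.cpow analyticAt_const hs).contDiffAt
  have h3 : distSq s ^ (1 / 2 : ℂ) ≠ 0 := by
    rw [cpow_ne_zero_iff_of_exponent_ne_zero (by norm_num)]
    exact slitPlane_ne_zero hs
  refine ContDiffAt.analyticAt ?_
  unfold perturbation
  exact contDiffAt_const.mul (ContDiffAt.sub (by fun_prop) (contDiffAt_const.div h2 h3))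

end

end CoOrbital

theorem theorem1 (P : CoOrbital.Params) (hG : 0 < P.G) (hm₀ : 0 < P.m₀) (hω : 0 < P.ω)
    (hm : ∀ j, 0 < P.m j) (hmax : max (P.m 0) (P.m 1) = P.m₀) :
    ∃ ρ₀ σ₀ M C₀ : ℝ, 0 < ρ₀ ∧ 0 < σ₀ ∧ 0 < M ∧ 1 < C₀ ∧
      ∀ ε : ℝ, 0 < ε → ε ≤ 1 →
        CoOrbital.KeplerianBound P ε ρ₀ M ∧
        ∃ U : CoOrbital.Coords → CoOrbital.State,
          ∀ Δ : ℝ, 0 < Δ → Δ < Real.pi →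
            CoOrbital.IsHolomorphicExtension P ε U (CoOrbital.dom Δ ρ₀ σ₀) ∧
            (∀ p ∈ CoOrbital.dom Δ ρ₀ σ₀, ‖fderiv ℂ U p‖ ≤ C₀) ∧
            ∀ C ρ σ : ℝ, 1 < C → (∀ p ∈ CoOrbital.dom Δ ρ₀ σ₀, ‖fderiv ℂ U p‖ ≤ C) →
              0 < ρ → ρ < σ → σ < 1 → ρ ≤ ρ₀ → σ ≤ σ₀ →
              σ ≤ CoOrbital.minDist P ε Δ / (16 * C) →
              (∀ p ∈ CoOrbital.dom Δ ρ σ,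
                CoOrbital.minDist P ε Δ / 2 ≤ CoOrbital.hermDist (U p) ∧
                CoOrbital.distSq (U p) ≠ 0) ∧
              AnalyticOnNhd ℂ (fun p => CoOrbital.perturbation P ε (U p))
                (CoOrbital.dom Δ ρ σ) ∧
              ε / M < sInf ((fun p => ‖CoOrbital.perturbation P ε (U p)‖) ''
                CoOrbital.dom Δ ρ σ) ∧
              BddAbove ((fun p => ‖CoOrbital.perturbation P ε (U p)‖) ''
                CoOrbital.dom Δ ρ σ) ∧
              sSup ((fun p => ‖CoOrbital.perturbation P ε (U p)‖) ''
                CoOrbital.dom Δ ρ σ) < M * ε / CoOrbital.minDist P ε Δ := by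
  open CoOrbital in
  obtain ⟨k, K, hk, hkK⟩ := exists_uniform_bounds hG hm₀ hω hm
  obtain ⟨r, B, hr, hB, hU⟩ := exists_extension hG hm₀ hω hm
  have hm0 := hm 0
  have hm1 := hm 1
  have hK : 0 < K := by
    obtain ⟨h1, h2⟩ := (hkK 0 le_rfl zero_le_one 0).1
    linarith
  set g : ℝ := P.G * P.m 0 * P.m 1 with hg
  have hg0 : 0 < g := by positivity
  -- `s₀` is the radius for Cauchy's estimate, `e₀` the admissible perturbation of the momenta
  set s₀ : ℝ := min (min (r / 4) (1 / 8)) (k / 4) with hs₀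
  have hs₀pos : 0 < s₀ := by positivity
  have hs₀r : s₀ ≤ r / 4 := (min_le_left _ _).trans (min_le_left _ _)
  have hs₀8 : s₀ ≤ 1 / 8 := (min_le_left _ _).trans (min_le_right _ _)
  have hs₀k : s₀ ≤ k / 4 := min_le_right _ _
  set C₀ : ℝ := B / s₀ + 2 with hC₀
  have hC₀2 : 2 ≤ C₀ := by rw [hC₀]; linarith [div_pos hB hs₀pos]
  set e₀ : ℝ := 0.05 * (g * P.m₀) / K / (4 * B) with he₀
  have he₀pos : 0 < e₀ := by positivity
  set σ₀ : ℝ := min s₀ (e₀ / C₀) with hσ₀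
  have hσ₀pos : 0 < σ₀ := by positivity
  have hσ₀s : σ₀ ≤ s₀ := min_le_left _ _
  have hσ₀e : C₀ * σ₀ ≤ e₀ := by
    have : σ₀ ≤ e₀ / C₀ := min_le_right _ _
    rw [le_div_iff₀ (by linarith)] at this
    linarith
  set M₁ : ℝ := K ^ 2 * K ^ 3 * (5 ^ 5 * 5 ^ 5) * (min (k / 2) 1)⁻¹ ^ 5 + 1 with hM₁
  have hM₁pos : 0 < M₁ := by positivity
  set M₃ : ℝ := 2 * B ^ 2 / P.m₀ * (2 * K) + 2 * g with hM₃
  have hM₃pos : 0 < M₃ := by positivity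
  set M₂ : ℝ := 20 * K / g with hM₂
  have hM₂pos : 0 < M₂ := by positivity
  refine ⟨σ₀, σ₀, M₁ + M₂ + M₃, C₀, hσ₀pos, hσ₀pos, by positivity, by linarith, ?_⟩
  intro ε hε hε1
  have hbd := hkK ε hε.le hε1
  have ha := fun j => resRadius_pos hG hm₀ hω hm hε.le j
  refine ⟨?_, ?_⟩
  · have hc : ∀ j, ‖(gravParam P ε j : ℂ) ^ 2 * (redMass P ε j : ℂ) ^ 3‖ ≤ K ^ 2 * K ^ 3 := by
      intro j
      have h1 := redMass_pos hm₀ hm hε.le j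
      have h2 := gravParam_pos hG hm₀ hm hε.le j
      rw [norm_mul, norm_pow, norm_pow, Complex.norm_real, Complex.norm_real,
        Real.norm_of_nonneg h1.le, Real.norm_of_nonneg h2.le]
      have := (hbd j).1.2
      have := (hbd j).2.1.2
      gcongr
    obtain ⟨h1, h2⟩ := keplerianBound_of_le hk (fun j => (hbd j).2.2.1.1) hc (hσ₀s.trans hs₀k)
    exact ⟨h1, fun a b hab z₁ z₂ hz₁ hz₂ => (h2 a b hab z₁ z₂ hz₁ hz₂).trans (by linarith)⟩
  obtain ⟨U, hcirc, hloc⟩ := hU ε hε.le hε1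
  refine ⟨U, fun Δ hΔ hΔπ => ?_⟩
  have hsqrt : √(σ₀ * σ₀) = σ₀ := Real.sqrt_mul_self hσ₀pos.le
  -- the ball of radius `s₀` about a point of the domain stays in the chart
  have hball : ∀ p ∈ dom Δ σ₀ σ₀, ∀ x ∈ Metric.closedBall p s₀,
      AnalyticAt ℂ U x ∧ ‖U x‖ ≤ B ∧ (IsRealPoint x → ∀ j, ∃ R r : Fin 2 → ℝ,
          IsKeplerState (redMass P ε j) (gravParam P ε j) (meanLong x j).re
            (actions P ε (Coords.Z x) j).re (Coords.ξ x j) R r ∧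
          (∀ i, (U x).1 j i = (R i : ℂ)) ∧ (∀ i, (U x).2 j i = (r i : ℂ))) := by
    intro p hp x hx
    refine hloc x fun j => ?_
    obtain ⟨h1, h2, h3, h4⟩ := hp.2 j
    rw [hsqrt] at h2 h3
    rw [mem_closedBall_iff_norm] at hx
    have hx1 := norm_prod_le_iff.1 hx
    have hx2 := norm_prod_le_iff.1 hx1.2
    have hx3 := norm_prod_le_iff.1 hx2.2
    have d1 : ‖Coords.ζ x j - Coords.ζ p j‖ ≤ s₀ := (norm_le_pi_norm (x - p).1 j).trans hx1.1
    have d2 : ‖Coords.Z x j - Coords.Z p j‖ ≤ s₀ := (norm_le_pi_norm (x - p).2.1 j).trans hx2.1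
    have d3 : ‖Coords.ξ x j - Coords.ξ p j‖ ≤ s₀ := (norm_le_pi_norm (x - p).2.2.1 j).trans hx3.1
    have d4 : ‖Coords.η x j - Coords.η p j‖ ≤ s₀ := (norm_le_pi_norm (x - p).2.2.2 j).trans hx3.2
    have htri : ∀ {a b : ℂ}, ‖a - b‖ ≤ s₀ → ‖b‖ ≤ σ₀ → ‖a‖ < r := fun {a b} hab hb => by
      have := norm_add_le (a - b) b
      rw [sub_add_cancel] at this
      linarith
    refine ⟨?_, htri d2 h1, htri d3 h2, htri d4 h3⟩
    have e1 := (Complex.abs_im_le_norm _).trans d1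
    rw [Complex.sub_im] at e1
    have e2 := abs_add_le ((Coords.ζ x j).im - (Coords.ζ p j).im) (Coords.ζ p j).im
    rw [sub_add_cancel] at e2
    linarith
  have hself : ∀ p ∈ dom Δ σ₀ σ₀, p ∈ Metric.closedBall p s₀ := fun p _ =>
    Metric.mem_closedBall_self hs₀pos.le
  have hder : ∀ p ∈ dom Δ σ₀ σ₀, ‖fderiv ℂ U p‖ ≤ C₀ := fun p hp =>
    (norm_fderiv_le_of_closedBall hs₀pos hB.le
      (fun x hx => (hball p hp x hx).1.differentiableAt) fun x hx => (hball p hp x hx).2.1).trans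
      (by rw [hC₀]; linarith)
  refine ⟨⟨fun p hp => (hball p hp p (hself p hp)).1,
    fun p hp => (hball p hp p (hself p hp)).2.2⟩, hder, ?_⟩
  intro C ρ σ hC hderC hρ hρσ _ hρρ₀ hσσ₀ hσδ
  set δ : ℝ := minDist P ε Δ with hδ
  have hδ0 : 0 < δ := minDist_pos (ha 0) (ha 1) hΔ hΔπ
  have hσ : 0 < σ := hρ.trans hρσ
  have hsub : dom Δ ρ σ ⊆ dom Δ σ₀ σ₀ := dom_mono hσ.le hσ₀pos.le hρρ₀ hσσ₀
  have hδK : δ ≤ 2 * K := by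
    have h1 : min (resRadius P ε 0) (resRadius P ε 1) ≤ K :=
      (min_le_left _ _).trans (hbd 0).2.2.2.2
    have h2 := mul_le_mul h1 (Real.sin_le_one (Δ / 2))
      (Real.sin_nonneg_of_nonneg_of_le_pi (by linarith) (by linarith)) hK.le
    rw [hδ, minDist]
    linarith
  have hest : ∀ p ∈ dom Δ ρ σ, δ / 2 ≤ hermDist (U p) ∧ distSq (U p) ∈ Complex.slitPlane ∧
      ε * (0.05 * g / K) ≤ ‖perturbation P ε (U p)‖ ∧
      ‖perturbation P ε (U p)‖ ≤ M₃ * ε / δ := by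
    intro p hp
    set θ : Fin 2 → ℝ := fun j => (Coords.ζ p j).re with hθ
    have hUc : U (circularPoint p) = circularState P ε θ := hcirc θ
    have hseg := segment_circularPoint_subset_dom hp
    have hmv : ∀ C' : ℝ, 0 ≤ C' → (∀ q ∈ dom Δ σ₀ σ₀, ‖fderiv ℂ U q‖ ≤ C') →
        ‖U p - circularState P ε θ‖ ≤ C' * σ := by
      intro C' hC' hq
      rw [← hUc]
      refine ((convex_segment (𝕜 := ℝ) (circularPoint p) p).norm_image_sub_le_of_norm_fderiv_le
        (𝕜 := ℂ) (fun x hx => ?_) (fun x hx => hq x (hsub (hseg hx)))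
        (left_mem_segment ℝ _ _) (right_mem_segment ℝ _ _)).trans
        (mul_le_mul_of_nonneg_left (norm_sub_circularPoint_le hp hσ.le hρσ.le) hC')
      exact (hball x (hsub (hseg hx)) x (hself x (hsub (hseg hx)))).1.differentiableAt
    have h1 : ‖U p - circularState P ε θ‖ ≤ e₀ :=
      (hmv C₀ (by linarith) hder).trans
        ((mul_le_mul_of_nonneg_left hσσ₀ (by linarith)).trans hσ₀e)
    have h2 : ‖U p - circularState P ε θ‖ ≤ δ / 16 := by
      refine (hmv C (by linarith) hderC).trans ?_
      rw [le_div_iff₀ (by linarith)] at hσδ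
      linarith
    have hchord := minDist_sq_le_chordSq (ha 0) (ha 1) hΔ hp.1
    rw [← hδ] at hchord
    set D : ℝ := √(chordSq (resRadius P ε 0) (resRadius P ε 1) (θ 0)) with hD
    have hD2 : D ^ 2 = chordSq (resRadius P ε 0) (resRadius P ε 1) (θ 0) :=
      Real.sq_sqrt ((sq_nonneg δ).trans hchord)
    have hδD : δ ≤ D := Real.le_sqrt_of_sq_le hchord
    have hD0 : 0 < D := hδ0.trans_le hδD
    have hpc := hseg (left_mem_segment ℝ (circularPoint p) p)
    obtain ⟨r1, r2, r3, r4⟩ := perturbation_estimates hG hm₀ hω hm hε.le (θ := θ) (s := U p)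
      (K := K) (e := e₀) (hball p (hsub hp) p (hself p (hsub hp))).2.1
      (hUc ▸ (hball _ (hsub hpc) _ (hself _ (hsub hpc))).2.1) (fun j => (hbd j).2.2.2.2) hD0 hD2 h1
      (h2.trans (by linarith)) (le_of_eq (by rw [he₀]; field_simp; exact hg))
    refine ⟨by linarith, r2, r3, r4.trans ?_⟩
    rw [mul_comm M₃, mul_div_assoc ε M₃]
    refine mul_le_mul_of_nonneg_left ?_ hε.le
    rw [hM₃, add_div]
    have e1 : 2 * B ^ 2 / P.m₀ ≤ 2 * B ^ 2 / P.m₀ * (2 * K) / δ := by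
      rw [le_div_iff₀ hδ0]
      exact mul_le_mul_of_nonneg_left hδK (by positivity)
    have e2 : g * (2 / D) ≤ 2 * g / δ := by
      rw [mul_div_assoc', mul_comm g]
      gcongr
    linarith
  have hne : ((fun p => ‖perturbation P ε (U p)‖) '' dom Δ ρ σ).Nonempty :=
    (dom_nonempty hΔπ hρ.le hσ.le).image _
  refine ⟨fun p hp => ⟨(hest p hp).1, Complex.slitPlane_ne_zero (hest p hp).2.1⟩, ?_, ?_, ?_, ?_⟩
  · intro p hp
    exact (analyticAt_perturbation (hest p hp).2.1).comp
      (hball p (hsub hp) p (hself p (hsub hp))).1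
  · have hlow : ε * (0.05 * g / K) ≤ sInf ((fun p => ‖perturbation P ε (U p)‖) '' dom Δ ρ σ) := by
      refine le_csInf hne ?_
      rintro _ ⟨p, hp, rfl⟩
      exact (hest p hp).2.2.1
    refine lt_of_lt_of_le ?_ hlow
    rw [div_lt_iff₀ (by positivity)]
    have h1 : ε * (0.05 * g / K) * M₂ = ε := by
      rw [hM₂]; field_simp; norm_num
    have h2 : 0 < ε * (0.05 * g / K) * (M₁ + M₃) := by positivity
    linarith
  · refine ⟨M₃ * ε / δ, ?_⟩
    rintro _ ⟨p, hp, rfl⟩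
    exact (hest p hp).2.2.2
  · have hup : sSup ((fun p => ‖perturbation P ε (U p)‖) '' dom Δ ρ σ) ≤ M₃ * ε / δ := by
      refine csSup_le hne ?_
      rintro _ ⟨p, hp, rfl⟩
      exact (hest p hp).2.2.2
    refine hup.trans_lt ?_
    have : M₃ * ε < (M₁ + M₂ + M₃) * ε := mul_lt_mul_of_pos_right (by linarith) hε
    gcongr
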